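/- Let $\mu_{\mathrm{sc}}$ be the standard semicircle law, with density $\frac{1}{2\pi}\sqrt{4-x^2}$ on $[-2,2]$, and let $\gamma$ be the standard Gaussian law on $\mathbb{R}$, with density $\frac{1}{\sqrt{2\pi}}e^{-x^2/2}$. There is exactly one probability measure $\rho$ on $\mathbb{R}$ that is the free additive convolution $\mu_{\mathrm{sc}}\boxplus\gamma$. It has a continuous density $p:\mathbb{R}\to[0,\infty)$ with respect to Lebesgue measure, and there is a constant $C>0$ such that $$p(x)\le C e^{-x^2/2}\qquad\text{for all } x\in\mathbb{R}.$$ Here, for a probability measure $\mu$ on $\mathbb{R}$, put $F_\mu(z)=\left(\int_{\mathbb{R}}\frac{d\mu(x)}{z-x}\right)^{-1}$ for $\operatorname{Im} z>0$, and for $\alpha,\beta>0$ let $\Gamma_{\alpha,\beta}=\{w\in\mathbb{C}: |\operatorname{Re} w|<\alpha\operatorname{Im} w,\ \operatorname{Im} w>\beta\}$. A Voiculescu transform of $\mu$ on $\Gamma_{\alpha,\beta}$ is an analytic function $\varphi:\Gamma_{\alpha,\beta}\to\mathbb{C}$ such that $\operatorname{Im}(w+\varphi(w))>0$ and $F_\mu(w+\varphi(w))=w$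 for all $w\in\Gamma_{\alpha,\beta}$, and $\varphi(w)=o(|w|)$ as $|w|\to\infty$ in $\Gamma_{\alpha,\beta}$. A probability measure $\rho$ is the free additive convolution of $\mu$ and $\nu$ if, for some $\alpha,\beta>0$, there are Voiculescu transforms $\varphi_\mu$ of $\mu$ and $\varphi_\nu$ of $\nu$ on $\Gamma_{\alpha,\beta}$ such that $\varphi_\mu+\varphi_\nu$ is a Voiculescu transform of $\rho$ on $\Gamma_{\alpha,\beta}$. -/

import Mathlib

open MeasureTheory ProbabilityTheory

namespace FreeProb

/-- The standard semicircle law on `[-2, 2]` (mean `0`, variance `1`), with Lebesgue density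
`√(4 - x²) / (2π)`. Outside `[-2, 2]` the real square root is `0`. -/
noncomputable def semicircleMeasure : Measure ℝ :=
  volume.withDensity fun x => ENNReal.ofReal (√(4 - x ^ 2) / (2 * Real.pi))

theorem integral_semicircle_density :
    ∫ x : ℝ, √(4 - x ^ 2) / (2 * Real.pi) = 1 := by
  have h1 : ∫ x : ℝ, √(4 - x ^ 2) = ∫ x in (-2 : ℝ)..2, √(4 - x ^ 2) := by
    rw [intervalIntegral.integral_of_le (by norm_num), ← integral_Icc_eq_integral_Ioc]
    symm
    apply setIntegral_eq_integral_of_forall_compl_eq_zero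
    intro x hx
    apply Real.sqrt_eq_zero_of_nonpos
    by_contra h
    exact hx ⟨by nlinarith, by nlinarith⟩
  have h2 : ∫ x in (-2 : ℝ)..2, √(4 - x ^ 2) = 2 * Real.pi := by
    have h3 := intervalIntegral.mul_integral_comp_mul_left (a := (-1 : ℝ)) (b := 1)
      (f := fun x : ℝ => √(4 - x ^ 2)) (c := 2)
    have h4 : ∀ x : ℝ, √(4 - (2 * x) ^ 2) = 2 * √(1 - x ^ 2) := by
      intro x
      rw [show (4 : ℝ) - (2 * x) ^ 2 = 2 ^ 2 * (1 - x ^ 2) by ring,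
        Real.sqrt_mul (by norm_num), Real.sqrt_sq (by norm_num)]
    simp only [h4, intervalIntegral.integral_const_mul, integral_sqrt_one_sub_sq] at h3
    norm_num at h3
    rw [← h3]
    ring
  rw [integral_div, h1, h2, div_self (by positivity)]

instance instIsProbabilityMeasureSemicircle : IsProbabilityMeasure semicircleMeasure := by
  constructor
  have hint : Integrable fun x : ℝ => √(4 - x ^ 2) / (2 * Real.pi) := by
    by_contra h
    have := integral_semicircle_density
    rw [integral_undef h] at this
    norm_num at this
  rw [semicircleMeasure, withDensity_apply _ MeasurableSet.univ, Measure.restrict_univ,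
    ← ofReal_integral_eq_lintegral_ofReal hint
      (Filter.Eventually.of_forall fun x => by positivity),
    integral_semicircle_density, ENNReal.ofReal_one]

/-- The standard semicircle law as a probability measure. -/
noncomputable def semicircleLaw : ProbabilityMeasure ℝ :=
  ⟨semicircleMeasure, inferInstance⟩

/-- The standard Gaussian law (mean `0`, variance `1`) as a probability measure. -/
noncomputable def gaussianLaw : ProbabilityMeasure ℝ :=
  ⟨gaussianReal 0 1, inferInstance⟩

/-- The Cauchy transform `G_μ(z) = ∫ 1 / (z - x) dμ(x)`; it is minus the Stieltjes transform. -/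
noncomputable def cauchyTransform (μ : ProbabilityMeasure ℝ) (z : ℂ) : ℂ :=
  ∫ x : ℝ, (z - (x : ℂ))⁻¹ ∂(μ : Measure ℝ)

/-- The reciprocal Cauchy transform `F_μ(z) = 1 / G_μ(z)`, used on the upper half-plane
(where `G_μ` does not vanish). -/
noncomputable def reciprocalCauchyTransform (μ : ProbabilityMeasure ℝ) (z : ℂ) : ℂ :=
  (cauchyTransform μ z)⁻¹

/-- The truncated cone `Γ_{α,β} = {w : |Re w| < α Im w, Im w > β}`. -/
def truncatedCone (α β : ℝ) : Set ℂ :=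
  {w | |w.re| < α * w.im ∧ β < w.im}

/-- `φ` is the Voiculescu transform of `μ` on `Γ_{α,β}`, i.e. `φ(w) = F_μ⁻¹(w) - w`, where
`F_μ⁻¹` is the analytic right inverse of `F_μ` with values in the upper half-plane and
`F_μ⁻¹(w) ∼ w` at infinity. Equivalently `φ(w) = R_μ(1 / w)` for the `R`-transform of `μ`. The
condition at infinity singles out the branch of the inverse, so that `φ` is unique. -/
structure IsVoiculescuTransform (μ : ProbabilityMeasure ℝ) (α β : ℝ) (φ : ℂ → ℂ) : Prop where
  analytic : DifferentiableOn ℂ φ (truncatedCone α β)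
  im_pos : ∀ w ∈ truncatedCone α β, 0 < (w + φ w).im
  right_inverse : ∀ w ∈ truncatedCone α β, reciprocalCauchyTransform μ (w + φ w) = w
  isLittleO : φ =o[Bornology.cobounded ℂ ⊓ Filter.principal (truncatedCone α β)] fun w => w

/-- `ρ = μ ⊞ ν`: the Voiculescu transforms (equivalently the `R`-transforms) of `μ` and `ν`, on
a common truncated cone, add up to that of `ρ`. -/
def IsFreeAdditiveConvolution (μ ν ρ : ProbabilityMeasure ℝ) : Prop :=
  ∃ α > 0, ∃ β > 0, ∃ φ₁ φ₂ : ℂ → ℂ,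
    IsVoiculescuTransform μ α β φ₁ ∧ IsVoiculescuTransform ν α β φ₂ ∧
      IsVoiculescuTransform ρ α β fun w => φ₁ w + φ₂ w

end FreeProb

namespace FreeProb

open Complex Filter Topology

/-! The proof uses Biane's description of free convolution with a semicircle law. Write `G` for the
Cauchy transform of the Gaussian law and `H w = w + G w`. Since `Im (H w) = Im w * (1 - ∫ |w - s|⁻²
dγ(s))`, the natural domain of `H` is the region where that integral is at most `1`. There `H` is
injective (`injOn_add_cauchyTransform`) and proper, and a connectedness argument shows that its
image contains the upper half-plane. So it has an inverse `ω`, continuous up to the real line and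
holomorphic above it.

The function `z - ω z = G (ω z)` decays like `1 / |z|`. By Cauchy's formula it is the Cauchy
transform of the density `Im ω(x) / π`, and its behaviour along `i y` gives total mass `1`; call
this measure `ρ`. If `g` inverts the reciprocal Cauchy transform of `γ` high in the half-plane, then
`G_ρ (g w + w⁻¹) = H (g w) - g w = w⁻¹`, so `ρ` has Voiculescu transform `w⁻¹ + (g w - w)`. The
first summand is the transform of the semicircle law, the second that of `γ`.

For the Gaussian bound, a boundary value `w = ω(x)` satisfies `∫ |w - s|⁻² dγ(s) = 1`. Hence `Im w`
is `π` times the Poisson integral of the Gaussian density at `w`. Splitting that integral near and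
far from `Re w` gives `Im w ≤ C exp (-(Re w)² / 2)` (`exists_im_le_mul_exp`). Finally `x² ≤ (Re w)²
+ 5`, so passing from `Re w` to `x` costs only a constant factor.

Uniqueness: any two Voiculescu transforms of one measure agree far up the imaginary axis. The
identity theorem and Stieltjes inversion then recover the measure. -/

/-! ### Cauchy transforms: differentiability and elementary bounds -/

theorem sub_ofReal_ne_zero {w : ℂ} (hw : 0 < w.im) (s : ℝ) : w - s ≠ 0 := by
  intro h
  have := congrArg Complex.im h
  simp at this
  linarith

theorem im_le_norm_sub_ofReal {w : ℂ} (s : ℝ) : w.im ≤ ‖w - s‖ := by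
  have := (le_abs_self _).trans (Complex.abs_im_le_norm (w - s))
  simpa using this

theorem norm_inv_sub_ofReal_le {w : ℂ} (hw : 0 < w.im) (s : ℝ) : ‖(w - s)⁻¹‖ ≤ w.im⁻¹ := by
  rw [norm_inv]
  exact inv_anti₀ hw (im_le_norm_sub_ofReal s)

theorem inv_normSq_sub_ofReal (w : ℂ) (s : ℝ) :
    (normSq (w - s))⁻¹ = ‖(w - s)⁻¹‖ ^ 2 := by
  rw [norm_inv, inv_pow, normSq_eq_norm_sq]

/-- The integral `∫ |w - s|⁻² dμ(s)`. -/
noncomputable def sqResolvent (μ : ProbabilityMeasure ℝ) (w : ℂ) : ℝ :=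
  ∫ s : ℝ, (normSq (w - (s : ℂ)))⁻¹ ∂(μ : Measure ℝ)

/-- `μ` has a finite second moment, mean `0` and variance `1`. -/
structure IsStandardized (μ : ProbabilityMeasure ℝ) : Prop where
  memLp : MemLp id 2 (μ : Measure ℝ)
  mean : ∫ s, s ∂(μ : Measure ℝ) = 0
  variance : ∫ s, s ^ 2 ∂(μ : Measure ℝ) = 1

section

variable (μ : ProbabilityMeasure ℝ) {w : ℂ}

theorem integrable_inv_sub (hw : 0 < w.im) :
    Integrable (fun s : ℝ => (w - (s : ℂ))⁻¹) (μ : Measure ℝ) :=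
  Integrable.of_bound (by fun_prop) w.im⁻¹ (.of_forall (norm_inv_sub_ofReal_le hw))

theorem integrable_inv_sub_mul_inv_sub {z : ℂ} (hw : 0 < w.im) (hz : 0 < z.im) :
    Integrable (fun s : ℝ => (w - (s : ℂ))⁻¹ * (z - (s : ℂ))⁻¹) (μ : Measure ℝ) := by
  refine Integrable.of_bound (by fun_prop) (w.im⁻¹ * z.im⁻¹) (.of_forall fun s => ?_)
  rw [norm_mul]
  exact mul_le_mul (norm_inv_sub_ofReal_le hw s) (norm_inv_sub_ofReal_le hz s) (norm_nonneg _)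
    (by positivity)

theorem integrable_inv_normSq_sub (hw : 0 < w.im) :
    Integrable (fun s : ℝ => (normSq (w - (s : ℂ)))⁻¹) (μ : Measure ℝ) := by
  refine (integrable_inv_sub_mul_inv_sub μ hw hw).norm.congr (.of_forall fun s => ?_)
  simp only [inv_normSq_sub_ofReal, norm_mul, sq]

theorem hasDerivAt_cauchyTransform (hw : 0 < w.im) :
    HasDerivAt (cauchyTransform μ) (∫ s : ℝ, -((w - (s : ℂ))⁻¹ * (w - (s : ℂ))⁻¹) ∂(μ : Measure ℝ))
      w := by
  have hs : {z : ℂ | w.im / 2 < z.im} ∈ 𝓝 w :=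
    (isOpen_lt continuous_const Complex.continuous_im).mem_nhds (by simp; linarith)
  refine (hasDerivAt_integral_of_dominated_loc_of_deriv_le (𝕜 := ℂ)
    (F := fun z (s : ℝ) => (z - (s : ℂ))⁻¹) (bound := fun _ => (w.im / 2)⁻¹ * (w.im / 2)⁻¹) hs
    (F' := fun z (s : ℝ) => -((z - (s : ℂ))⁻¹ * (z - (s : ℂ))⁻¹)) (.of_forall fun z => by fun_prop)
    (integrable_inv_sub μ hw) (by fun_prop) (.of_forall fun s z hz => ?_)
    (integrable_const _) (.of_forall fun s z hz => ?_)).2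
  · have hz' : w.im / 2 < z.im := hz
    have h1 : ‖(z - (s : ℂ))⁻¹‖ ≤ (w.im / 2)⁻¹ :=
      (norm_inv_sub_ofReal_le (by linarith) s).trans (inv_anti₀ (by linarith) hz'.le)
    rw [norm_neg, norm_mul]
    exact mul_le_mul h1 h1 (norm_nonneg _) (by positivity)
  · have hz' : w.im / 2 < z.im := hz
    have h := ((hasDerivAt_id z).sub_const (s : ℂ)).inv
      (sub_ofReal_ne_zero (w := z) (by linarith) s)
    refine h.congr_deriv ?_
    simp [div_eq_mul_inv, sq]

theorem differentiableOn_cauchyTransform :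
    DifferentiableOn ℂ (cauchyTransform μ) {z | 0 < z.im} :=
  fun _ hz => (hasDerivAt_cauchyTransform μ hz).differentiableAt.differentiableWithinAt

theorem isOpen_upperHalfPlane : IsOpen {z : ℂ | 0 < z.im} :=
  isOpen_lt continuous_const Complex.continuous_im

theorem hasStrictDerivAt_cauchyTransform (hw : 0 < w.im) :
    HasStrictDerivAt (cauchyTransform μ)
      (∫ s : ℝ, -((w - (s : ℂ))⁻¹ * (w - (s : ℂ))⁻¹) ∂(μ : Measure ℝ)) w := by
  have h1 : AnalyticAt ℂ (cauchyTransform μ) w :=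
    (differentiableOn_cauchyTransform μ).analyticAt (isOpen_upperHalfPlane.mem_nhds hw)
  have h2 := h1.hasStrictDerivAt
  rwa [(hasDerivAt_cauchyTransform μ hw).deriv] at h2

theorem im_cauchyTransform (hw : 0 < w.im) :
    (cauchyTransform μ w).im = -(w.im * sqResolvent μ w) := by
  have h := integral_im (integrable_inv_sub μ hw)
  simp only [RCLike.im_to_complex] at h
  rw [cauchyTransform, ← h, sqResolvent, ← integral_const_mul, ← integral_neg]
  congr 1 with s
  simp [Complex.inv_im, div_eq_mul_inv]

theorem sqResolvent_pos (hw : 0 < w.im) : 0 < sqResolvent μ w := by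
  rw [sqResolvent, integral_pos_iff_support_of_nonneg
    (fun s => inv_nonneg.2 (normSq_nonneg _)) (integrable_inv_normSq_sub μ hw)]
  have : Function.support (fun s : ℝ => (normSq (w - (s : ℂ)))⁻¹) = Set.univ := by
    ext s
    simpa using sub_ofReal_ne_zero hw s
  simp [this]

theorem im_cauchyTransform_neg (hw : 0 < w.im) : (cauchyTransform μ w).im < 0 := by
  rw [im_cauchyTransform μ hw]
  have := mul_pos hw (sqResolvent_pos μ hw)
  linarith

theorem cauchyTransform_ne_zero (hw : 0 < w.im) : cauchyTransform μ w ≠ 0 := by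
  intro h
  have := im_cauchyTransform_neg μ hw
  simp [h] at this

theorem norm_cauchyTransform_le (hw : 0 < w.im) : ‖cauchyTransform μ w‖ ≤ w.im⁻¹ := by
  have := norm_integral_le_of_norm_le_const (μ := (μ : Measure ℝ))
    (.of_forall (norm_inv_sub_ofReal_le hw))
  simpa [cauchyTransform] using this

theorem sqResolvent_le (hw : 0 < w.im) : sqResolvent μ w ≤ (w.im⁻¹) ^ 2 := by
  have h : sqResolvent μ w ≤ ∫ _ : ℝ, (w.im⁻¹) ^ 2 ∂(μ : Measure ℝ) := by
    refine integral_mono (integrable_inv_normSq_sub μ hw) (integrable_const _) fun s => ?_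
    simp only [inv_normSq_sub_ofReal]
    exact pow_le_pow_left₀ (norm_nonneg _) (norm_inv_sub_ofReal_le hw s) 2
  simpa using h

/-- Follows from `2 t ≤ 1 + t²` with `t = |w - s|⁻¹`. Unlike the bound by `1 / Im w`, it is uniform
near the real line. -/
theorem norm_cauchyTransform_le_one (hw : 0 < w.im) (h : sqResolvent μ w ≤ 1) :
    ‖cauchyTransform μ w‖ ≤ 1 := by
  have h1 : ∫ s : ℝ, ‖(w - (s : ℂ))⁻¹‖ ∂(μ : Measure ℝ) ≤
      ∫ s : ℝ, (1 + (normSq (w - (s : ℂ)))⁻¹) / 2 ∂(μ : Measure ℝ) := by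
    refine integral_mono (integrable_inv_sub μ hw).norm
      (((integrable_const _).add (integrable_inv_normSq_sub μ hw)).div_const _) fun s => ?_
    simp only [inv_normSq_sub_ofReal]
    nlinarith [sq_nonneg (‖(w - (s : ℂ))⁻¹‖ - 1)]
  rw [integral_div, integral_add (integrable_const _) (integrable_inv_normSq_sub μ hw)] at h1
  change _ ≤ (_ + sqResolvent μ w) / 2 at h1
  refine (norm_integral_le_integral_norm _).trans (h1.trans ?_)
  simp
  linarith

theorem continuousAt_sqResolvent (hw : 0 < w.im) : ContinuousAt (sqResolvent μ) w := by
  have h1 : ContinuousAt (fun z => -(cauchyTransform μ z).im / z.im) w :=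
    ((Complex.continuous_im.continuousAt.comp
      (hasDerivAt_cauchyTransform μ hw).continuousAt).neg).div
      Complex.continuous_im.continuousAt hw.ne'
  refine h1.congr ?_
  filter_upwards [isOpen_upperHalfPlane.mem_nhds hw] with z hz
  have hz' : 0 < z.im := hz
  rw [im_cauchyTransform μ hz', neg_neg, mul_div_cancel_left₀ _ hz'.ne']

variable {μ}

theorem IsStandardized.integrable_sq (hμ : IsStandardized μ) :
    Integrable (fun s : ℝ => s ^ 2) (μ : Measure ℝ) :=
  hμ.memLp.integrable_sq

theorem IsStandardized.integrable_id (hμ : IsStandardized μ) :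
    Integrable (fun s : ℝ => s) (μ : Measure ℝ) :=
  hμ.memLp.integrable (by norm_num)

/-- Expand `w / (w - s) = 1 + s / w + s² / (w (w - s))`: the mean kills the linear term and the
variance bounds the remainder. -/
theorem IsStandardized.norm_mul_cauchyTransform_sub_one_le (hμ : IsStandardized μ)
    (hw : 0 < w.im) : ‖w * cauchyTransform μ w - 1‖ ≤ (‖w‖ * w.im)⁻¹ := by
  have hsq := hμ.integrable_sq
  have hid := hμ.integrable_id
  have hw0 : w ≠ 0 := by rintro rfl; simp at hw
  have e1 : ∀ s : ℝ, w * (w - (s : ℂ))⁻¹ = 1 + (w⁻¹ * s + w⁻¹ * ((s : ℂ) ^ 2 * (w - s)⁻¹)) := by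
    intro s
    have := sub_ofReal_ne_zero hw s
    field_simp
    ring
  have i3 : Integrable (fun s : ℝ => (s : ℂ) ^ 2 * (w - s)⁻¹) (μ : Measure ℝ) := by
    refine (hsq.ofReal (𝕜 := ℂ)).mul_bdd (c := w.im⁻¹) (by fun_prop)
      (.of_forall (norm_inv_sub_ofReal_le hw)) |>.congr (.of_forall fun s => ?_)
    simp
  have e2 : w * cauchyTransform μ w - 1 =
      w⁻¹ * ∫ s : ℝ, (s : ℂ) ^ 2 * (w - s)⁻¹ ∂(μ : Measure ℝ) := by
    rw [cauchyTransform, ← integral_const_mul]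
    simp only [e1]
    have ia : Integrable (fun s : ℝ => w⁻¹ * (s : ℂ)) (μ : Measure ℝ) :=
      (hid.ofReal (𝕜 := ℂ)).const_mul _
    have ib := i3.const_mul w⁻¹
    have iab : Integrable (fun s : ℝ => w⁻¹ * (s : ℂ) + w⁻¹ * ((s : ℂ) ^ 2 * (w - s)⁻¹))
      (μ : Measure ℝ) := ia.add ib
    rw [integral_add (integrable_const _) iab, integral_add ia ib,
      integral_const_mul, integral_const_mul]
    have : ∫ s : ℝ, (s : ℂ) ∂(μ : Measure ℝ) = 0 := by
      simpa [hμ.mean] using integral_ofReal (𝕜 := ℂ) (μ := (μ : Measure ℝ)) (f := fun s : ℝ => s)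
    simp [this]
  rw [e2, norm_mul, norm_inv, mul_inv]
  refine mul_le_mul_of_nonneg_left ?_ (by positivity)
  have h4 : ‖∫ s : ℝ, (s : ℂ) ^ 2 * (w - s)⁻¹ ∂(μ : Measure ℝ)‖ ≤
      ∫ s : ℝ, s ^ 2 * w.im⁻¹ ∂(μ : Measure ℝ) := by
    refine norm_integral_le_of_norm_le (hsq.mul_const _) (.of_forall fun s => ?_)
    rw [norm_mul, norm_pow, norm_real, Real.norm_eq_abs, sq_abs]
    exact mul_le_mul_of_nonneg_left (norm_inv_sub_ofReal_le hw s) (sq_nonneg s)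
  rwa [integral_mul_const, hμ.variance, one_mul] at h4

theorem mul_cauchyTransform_eq (hw : 0 < w.im) :
    w * cauchyTransform μ w = 1 + ∫ s : ℝ, s * (w - (s : ℂ))⁻¹ ∂(μ : Measure ℝ) := by
  have e : ∀ s : ℝ, (s : ℂ) * (w - s)⁻¹ = w * (w - s)⁻¹ - 1 := by
    intro s
    have := sub_ofReal_ne_zero hw s
    field_simp
    ring
  simp only [e]
  rw [integral_sub ((integrable_inv_sub μ hw).const_mul _) (integrable_const _),
    integral_const_mul, cauchyTransform]
  simp

/-- Here `w G(w) = 1 + ∫ s / (w - s)`, and `2ab ≤ a² + b²` bounds the integral by `(1 + 1) / 2`. The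
bound does not depend on `Im w`, so it serves for boundary values. -/
theorem IsStandardized.norm_mul_cauchyTransform_le (hμ : IsStandardized μ) (hw : 0 < w.im)
    (h : sqResolvent μ w ≤ 1) : ‖w * cauchyTransform μ w‖ ≤ 2 := by
  have h1 : ‖∫ s : ℝ, s * (w - (s : ℂ))⁻¹ ∂(μ : Measure ℝ)‖ ≤
      ∫ s : ℝ, (s ^ 2 + (normSq (w - (s : ℂ)))⁻¹) / 2 ∂(μ : Measure ℝ) := by
    refine norm_integral_le_of_norm_le
      ((hμ.integrable_sq.add (integrable_inv_normSq_sub μ hw)).div_const _) (.of_forall fun s => ?_)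
    rw [inv_normSq_sub_ofReal, norm_mul, norm_real, Real.norm_eq_abs, ← sq_abs s]
    nlinarith [sq_nonneg (|s| - ‖(w - (s : ℂ))⁻¹‖)]
  rw [integral_div, integral_add hμ.integrable_sq (integrable_inv_normSq_sub μ hw),
    hμ.variance] at h1
  change _ ≤ (1 + sqResolvent μ w) / 2 at h1
  rw [mul_cauchyTransform_eq hw]
  refine (norm_add_le _ _).trans ?_
  rw [norm_one]
  linarith

end

/-! ### The subordination function as the inverse of `w ↦ w + G_μ(w)` -/

/-- The closed region `{Im w > 0, ∫ |w - s|⁻² dμ(s) ≤ 1}` on which `w ↦ w + G_μ(w)` inverts the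
subordination function of `μ_sc ⊞ μ`. -/
def subordinationDomain (μ : ProbabilityMeasure ℝ) : Set ℂ :=
  {w | 0 < w.im ∧ sqResolvent μ w ≤ 1}

section

variable (μ : ProbabilityMeasure ℝ) {w : ℂ}

theorem im_add_cauchyTransform (hw : 0 < w.im) :
    (w + cauchyTransform μ w).im = w.im * (1 - sqResolvent μ w) := by
  rw [add_im, im_cauchyTransform μ hw]
  ring

/-- The inequality is strict because both inverses lie in the lower half-plane, so the product of
their imaginary parts is positive. Strictness is what admits the boundary case `sqResolvent = 1`
below. -/
theorem re_inv_mul_inv_lt {a b : ℂ} (ha : 0 < a.im) (hb : 0 < b.im) :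
    (a⁻¹ * b⁻¹).re < ((normSq a)⁻¹ + (normSq b)⁻¹) / 2 := by
  have h1 : (a⁻¹).im < 0 := by
    rw [inv_im]
    exact div_neg_of_neg_of_pos (by linarith) (normSq_pos.2 (by rintro rfl; simp at ha))
  have h2 : (b⁻¹).im < 0 := by
    rw [inv_im]
    exact div_neg_of_neg_of_pos (by linarith) (normSq_pos.2 (by rintro rfl; simp at hb))
  rw [← map_inv₀ normSq a, ← map_inv₀ normSq b, mul_re, normSq_apply, normSq_apply]
  nlinarith [sq_nonneg ((a⁻¹).re - (b⁻¹).re), sq_nonneg ((a⁻¹).im - (b⁻¹).im),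
    mul_pos_of_neg_of_neg h1 h2]

theorem re_integral_inv_mul_inv_lt {a b : ℂ} (ha : 0 < a.im) (hb : 0 < b.im) :
    (∫ s : ℝ, (a - (s : ℂ))⁻¹ * (b - (s : ℂ))⁻¹ ∂(μ : Measure ℝ)).re <
      (sqResolvent μ a + sqResolvent μ b) / 2 := by
  have i1 := integrable_inv_sub_mul_inv_sub μ ha hb
  have i2 := integrable_inv_normSq_sub μ ha
  have i3 := integrable_inv_normSq_sub μ hb
  have h := integral_re i1
  simp only [RCLike.re_to_complex] at h
  have i4 : Integrable (fun s : ℝ => ((normSq (a - (s : ℂ)))⁻¹ + (normSq (b - (s : ℂ)))⁻¹) / 2)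
    (μ : Measure ℝ) := (i2.add i3).div_const 2
  have i5 : Integrable (fun s : ℝ => ((a - (s : ℂ))⁻¹ * (b - (s : ℂ))⁻¹).re) (μ : Measure ℝ) :=
    i1.re
  rw [← h, sqResolvent, sqResolvent, ← integral_add i2 i3, ← integral_div, ← sub_pos,
    ← integral_sub i4 i5]
  have hpos : ∀ s : ℝ, 0 < ((normSq (a - (s : ℂ)))⁻¹ + (normSq (b - (s : ℂ)))⁻¹) / 2 -
      ((a - (s : ℂ))⁻¹ * (b - (s : ℂ))⁻¹).re := fun s =>
    sub_pos.2 (re_inv_mul_inv_lt (by simpa using ha) (by simpa using hb))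
  rw [integral_pos_iff_support_of_nonneg (fun s => (hpos s).le) (i4.sub i5)]
  have : Function.support (fun s : ℝ => ((normSq (a - (s : ℂ)))⁻¹ +
      (normSq (b - (s : ℂ)))⁻¹) / 2 - ((a - (s : ℂ))⁻¹ * (b - (s : ℂ))⁻¹).re) = Set.univ :=
    Set.eq_univ_of_forall fun s => (hpos s).ne'
  rw [this]
  simp

theorem cauchyTransform_sub_cauchyTransform {a b : ℂ} (ha : 0 < a.im) (hb : 0 < b.im) :
    cauchyTransform μ a - cauchyTransform μ b =
      (b - a) * ∫ s : ℝ, (a - (s : ℂ))⁻¹ * (b - (s : ℂ))⁻¹ ∂(μ : Measure ℝ) := by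
  rw [cauchyTransform, cauchyTransform, ← integral_sub (integrable_inv_sub μ ha)
    (integrable_inv_sub μ hb), ← integral_const_mul]
  congr 1 with s
  have := sub_ofReal_ne_zero ha s
  have := sub_ofReal_ne_zero hb s
  field_simp
  ring

/-- The difference of two values factors as `(a - b) (1 - I)` with `I = ∫ (a - s)⁻¹ (b - s)⁻¹`, and
`Re I < 1` on the domain. -/
theorem injOn_add_cauchyTransform :
    Set.InjOn (fun w => w + cauchyTransform μ w) (subordinationDomain μ) := by
  intro a ha b hb hab
  by_contra hne
  have h1 := cauchyTransform_sub_cauchyTransform μ ha.1 hb.1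
  set I := ∫ s : ℝ, (a - (s : ℂ))⁻¹ * (b - (s : ℂ))⁻¹ ∂(μ : Measure ℝ) with hI
  have h2 : (b - a) * (I - 1) = 0 := by
    have : a + cauchyTransform μ a = b + cauchyTransform μ b := hab
    linear_combination -h1 + this
  have h3 : I = 1 := by
    rcases mul_eq_zero.1 h2 with h | h
    · exact absurd (sub_eq_zero.1 h).symm hne
    · exact sub_eq_zero.1 h
  have h4 := re_integral_inv_mul_inv_lt μ ha.1 hb.1
  rw [← hI, h3, one_re] at h4
  linarith [ha.2, hb.2]

/-- The infinitesimal form of injectivity: the same estimate with `a = b = w`. -/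
theorem deriv_add_cauchyTransform_ne_zero (hw : w ∈ subordinationDomain μ) :
    1 + ∫ s : ℝ, -((w - (s : ℂ))⁻¹ * (w - (s : ℂ))⁻¹) ∂(μ : Measure ℝ) ≠ 0 := by
  intro h
  have h4 := re_integral_inv_mul_inv_lt μ hw.1 hw.1
  rw [integral_neg, add_neg_eq_zero] at h
  rw [← h, one_re] at h4
  linarith [hw.2]

theorem hasStrictDerivAt_add_cauchyTransform (hw : 0 < w.im) :
    HasStrictDerivAt (fun w => w + cauchyTransform μ w)
      (1 + ∫ s : ℝ, -((w - (s : ℂ))⁻¹ * (w - (s : ℂ))⁻¹) ∂(μ : Measure ℝ)) w :=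
  (hasStrictDerivAt_id w).add (hasStrictDerivAt_cauchyTransform μ hw)

theorem continuousOn_add_cauchyTransform :
    ContinuousOn (fun w => w + cauchyTransform μ w) (subordinationDomain μ) := fun _ hw =>
  (hasStrictDerivAt_add_cauchyTransform μ hw.1).hasDerivAt.continuousAt.continuousWithinAt

/-- The points of the subordination domain in any bounded set stay away from the real line. This
holds if `μ` has a density that is locally bounded below. -/
def ImBoundedBelow (μ : ProbabilityMeasure ℝ) : Prop :=
  ∀ R : ℝ, ∃ δ > 0, ∀ w ∈ subordinationDomain μ, ‖w‖ ≤ R → δ ≤ w.im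

variable {μ}

theorem isClosed_subordinationDomain (hμ : ImBoundedBelow μ) :
    IsClosed (subordinationDomain μ) := by
  refine isClosed_of_closure_subset fun w hw => ?_
  obtain ⟨u, hu, huw⟩ := mem_closure_iff_seq_limit.1 hw
  obtain ⟨R, hR⟩ := (Metric.isBounded_range_of_tendsto u huw).exists_norm_le
  obtain ⟨δ, hδ, h⟩ := hμ R
  have h1 : δ ≤ w.im := ge_of_tendsto' ((Complex.continuous_im.tendsto w).comp huw)
    fun n => h _ (hu n) (hR _ ⟨n, rfl⟩)
  have h2 : 0 < w.im := hδ.trans_le h1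
  exact ⟨h2, le_of_tendsto' ((continuousAt_sqResolvent μ h2).tendsto.comp huw) fun n => (hu n).2⟩

theorem isCompact_subordinationDomain_inter_closedBall (hμ : ImBoundedBelow μ) (R : ℝ) :
    IsCompact (subordinationDomain μ ∩ Metric.closedBall 0 R) :=
  (isCompact_closedBall 0 R).inter_left (isClosed_subordinationDomain hμ)

theorem norm_le_of_add_cauchyTransform_eq {z : ℂ} (hw : w ∈ subordinationDomain μ)
    (h : w + cauchyTransform μ w = z) : ‖w‖ ≤ ‖z‖ + 1 := by
  have h1 := norm_cauchyTransform_le_one μ hw.1 hw.2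
  have h2 : w = z - cauchyTransform μ w := by rw [← h]; ring
  calc ‖w‖ = ‖z - cauchyTransform μ w‖ := by rw [← h2]
    _ ≤ ‖z‖ + ‖cauchyTransform μ w‖ := norm_sub_le _ _
    _ ≤ ‖z‖ + 1 := by linarith

/-- The map is proper: since `|G| ≤ 1` on the domain, preimages of bounded sets are bounded, and
bounded parts of the domain are compact. -/
theorem isClosed_image_add_cauchyTransform (hμ : ImBoundedBelow μ) :
    IsClosed ((fun w => w + cauchyTransform μ w) '' subordinationDomain μ) := by
  refine isClosed_of_closure_subset fun z hz => ?_
  obtain ⟨u, hu, huz⟩ := mem_closure_iff_seq_limit.1 hz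
  obtain ⟨R, hR⟩ := (Metric.isBounded_range_of_tendsto u huz).exists_norm_le
  have hK := (isCompact_subordinationDomain_inter_closedBall hμ (R + 1)).image_of_continuousOn
    ((continuousOn_add_cauchyTransform μ).mono Set.inter_subset_left)
  refine Set.image_mono Set.inter_subset_left (hK.isClosed.mem_of_tendsto huz (.of_forall ?_))
  intro n
  obtain ⟨w, hw, hwu⟩ := hu n
  refine ⟨w, ⟨hw, ?_⟩, hwu⟩
  rw [mem_closedBall_zero_iff]
  linarith [norm_le_of_add_cauchyTransform_eq hw hwu, hR _ ⟨n, rfl⟩]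

theorem sqResolvent_lt_one_of_im_pos (hw : 0 < w.im) (h : 0 < (w + cauchyTransform μ w).im) :
    sqResolvent μ w < 1 := by
  rw [im_add_cauchyTransform μ hw] at h
  linarith [(pos_iff_pos_of_mul_pos h).1 hw]

theorem subordinationDomain_mem_nhds (hw : 0 < w.im) (h : sqResolvent μ w < 1) :
    subordinationDomain μ ∈ 𝓝 w := by
  filter_upwards [isOpen_upperHalfPlane.mem_nhds hw,
    (continuousAt_sqResolvent μ hw).eventually_lt continuousAt_const h] with z h1 h2
  exact ⟨h1, h2.le⟩

/-- Connectedness: inside the upper half-plane the image is nonempty, closed and open. It is open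
because a point mapping there has `sqResolvent < 1`, hence is interior to the domain, and the
inverse function theorem applies. -/
theorem upperHalfPlane_subset_image_add_cauchyTransform (hμ : ImBoundedBelow μ) :
    {z : ℂ | 0 < z.im} ⊆ (fun w => w + cauchyTransform μ w) '' subordinationDomain μ := by
  have hc : IsPreconnected {z : ℂ | 0 < z.im} := (convex_halfSpace_im_gt 0).isPreconnected
  set A := (fun w => w + cauchyTransform μ w) '' subordinationDomain μ with hA
  have hopen : {z : ℂ | 0 < z.im} ∩ A ⊆ interior A := by
    rintro z ⟨hz, w, hw, rfl⟩
    have h1 : sqResolvent μ w < 1 := sqResolvent_lt_one_of_im_pos hw.1 hz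
    rw [mem_interior_iff_mem_nhds]
    have h2 := (hasStrictDerivAt_add_cauchyTransform μ hw.1).map_nhds_eq
      (deriv_add_cauchyTransform_ne_zero μ hw)
    simp only at h2 ⊢
    rw [← h2]
    exact image_mem_map (subordinationDomain_mem_nhds hw.1 h1)
  have h := hc.subset_of_closure_inter_subset (u := interior A) isOpen_interior ?_ ?_
  · exact h.trans interior_subset
  -- Nonemptiness: at `2i` the integral is at most `1/4`, so the image lies in the upper half-plane.
  · have h2 : (0 : ℝ) < (2 * I : ℂ).im := by simp
    have h3 : sqResolvent μ (2 * I) < 1 :=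
      (sqResolvent_le μ h2).trans_lt (by norm_num)
    have h4 : 0 < (2 * I + cauchyTransform μ (2 * I)).im := by
      rw [im_add_cauchyTransform μ h2]
      exact mul_pos h2 (by linarith)
    exact ⟨_, h4, hopen ⟨h4, _, ⟨h2, h3.le⟩, rfl⟩⟩
  · rintro z ⟨hz1, hz2⟩
    refine hopen ⟨hz2, ?_⟩
    exact (isClosed_image_add_cauchyTransform hμ).closure_subset_iff.2 interior_subset hz1

theorem exists_add_cauchyTransform_eq (hμ : ImBoundedBelow μ) {z : ℂ} (hz : 0 ≤ z.im) :
    ∃ w ∈ subordinationDomain μ, w + cauchyTransform μ w = z := by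
  have h := closure_mono (upperHalfPlane_subset_image_add_cauchyTransform hμ)
  rw [(isClosed_image_add_cauchyTransform hμ).closure_eq, Complex.closure_setOfPred_lt_im] at h
  exact h hz

/-- The inverse of `w ↦ w + G_μ(w)` on the closed upper half-plane: the subordination function
of `μ_sc ⊞ μ` with respect to `μ`. -/
noncomputable def subordination (μ : ProbabilityMeasure ℝ) (z : ℂ) : ℂ :=
  Function.invFunOn (fun w => w + cauchyTransform μ w) (subordinationDomain μ) z

theorem subordination_mem (hμ : ImBoundedBelow μ) {z : ℂ} (hz : 0 ≤ z.im) :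
    subordination μ z ∈ subordinationDomain μ :=
  Function.invFunOn_mem (exists_add_cauchyTransform_eq hμ hz)

theorem subordination_add (hμ : ImBoundedBelow μ) {z : ℂ} (hz : 0 ≤ z.im) :
    subordination μ z + cauchyTransform μ (subordination μ z) = z :=
  Function.invFunOn_eq (exists_add_cauchyTransform_eq hμ hz)

theorem subordination_add_cauchyTransform (hw : w ∈ subordinationDomain μ) :
    subordination μ (w + cauchyTransform μ w) = w :=
  (injOn_add_cauchyTransform μ).leftInvOn_invFunOn hw

/-- Near `z` the values stay in a compact part of the domain, and each cluster point `w` solves `w +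
G(w) = z`; injectivity leaves only one. -/
theorem continuousOn_subordination (hμ : ImBoundedBelow μ) :
    ContinuousOn (subordination μ) {z | 0 ≤ z.im} := by
  intro z hz
  refine (isCompact_subordinationDomain_inter_closedBall hμ
    (‖z‖ + 2)).tendsto_nhds_of_unique_mapClusterPt ?_ ?_
  · have h1 : ∀ᶠ x in 𝓝[{z | 0 ≤ z.im}] z, ‖x‖ < ‖z‖ + 1 :=
      mem_nhdsWithin_of_mem_nhds (continuous_norm.continuousAt.eventually_lt continuousAt_const
        (by linarith))
    filter_upwards [h1, self_mem_nhdsWithin] with x hx hx'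
    refine ⟨subordination_mem hμ hx', ?_⟩
    rw [mem_closedBall_zero_iff]
    linarith [norm_le_of_add_cauchyTransform_eq (subordination_mem hμ hx')
      (subordination_add hμ hx')]
  · intro w hw hc
    have h1 : ContinuousAt (fun w => w + cauchyTransform μ w) w :=
      (hasStrictDerivAt_add_cauchyTransform μ hw.1.1).hasDerivAt.continuousAt
    have h2 := hc.tendsto_comp h1.tendsto
    have h3 : Tendsto ((fun w => w + cauchyTransform μ w) ∘ subordination μ)
        (𝓝[{z | 0 ≤ z.im}] z) (𝓝 z) := by
      refine (tendsto_nhdsWithin_of_tendsto_nhds tendsto_id).congr' ?_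
      filter_upwards [self_mem_nhdsWithin] with x hx
      exact (subordination_add hμ hx).symm
    have h4 : w + cauchyTransform μ w = z := by
      have h5 : ClusterPt (w + cauchyTransform μ w) (𝓝 z) := ClusterPt.mono h2 h3
      exact eq_of_nhds_neBot h5
    rw [← h4, subordination_add_cauchyTransform hw.1]

theorem differentiableAt_subordination (hμ : ImBoundedBelow μ) {z : ℂ} (hz : 0 < z.im) :
    DifferentiableAt ℂ (subordination μ) z := by
  have hmem : {z : ℂ | 0 < z.im} ∈ 𝓝 z := isOpen_upperHalfPlane.mem_nhds hz
  have hω := subordination_mem hμ hz.le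
  refine (HasDerivAt.of_local_left_inverse (f := fun w => w + cauchyTransform μ w) ?_
    (hasStrictDerivAt_add_cauchyTransform μ hω.1).hasDerivAt
    (deriv_add_cauchyTransform_ne_zero μ hω) ?_).differentiableAt
  · exact (continuousOn_subordination hμ).continuousAt
      (mem_of_superset hmem fun x (hx : 0 < x.im) => hx.le)
  · filter_upwards [hmem] with x hx
    exact subordination_add hμ (le_of_lt hx)

end

/-! ### Cauchy's formula and Stieltjes inversion on the closed half-plane -/

/-- Cauchy's theorem in the upper half-plane, for functions decaying like `|z|⁻²`. -/
theorem integral_real_line_eq_zero {k : ℂ → ℂ} {s : Set ℂ} (hs : s.Countable)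
    (hc : ContinuousOn k {z | 0 ≤ z.im}) (hd : ∀ z : ℂ, 0 < z.im → z ∉ s → DifferentiableAt ℂ k z)
    (hi : Integrable fun x : ℝ => k x) {C R₀ : ℝ}
    (hb : ∀ z : ℂ, 0 ≤ z.im → R₀ ≤ ‖z‖ → ‖k z‖ ≤ C / ‖z‖ ^ 2) :
    ∫ x : ℝ, k x = 0 := by
  have h1 : Tendsto (fun R : ℝ => ∫ x in (-R)..R, k x) atTop (𝓝 (∫ x : ℝ, k x)) :=
    intervalIntegral_tendsto_integral hi tendsto_neg_atTop_atBot tendsto_id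
  refine tendsto_nhds_unique h1 ?_
  have h2 : Tendsto (fun R : ℝ => 4 * C * R⁻¹) atTop (𝓝 0) := by
    simpa using tendsto_inv_atTop_zero.const_mul (4 * C)
  refine squeeze_zero_norm' ?_ h2
  filter_upwards [eventually_ge_atTop R₀, eventually_gt_atTop 0] with R hR hR0
  have hC : 0 ≤ C := by
    have h := (norm_nonneg _).trans (hb (R * I) (by simpa using hR0.le)
      (by simpa [abs_of_pos hR0] using hR))
    by_contra hC
    exact absurd h (not_le.2 (div_neg_of_neg_of_pos (not_le.1 hC)
      (by simp; positivity)))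
  have hbR : ∀ z : ℂ, 0 ≤ z.im → R ≤ ‖z‖ → ‖k z‖ ≤ C / R ^ 2 := fun z hz hRz =>
    (hb z hz (hR.trans hRz)).trans
      (div_le_div_of_nonneg_left hC (by positivity) (pow_le_pow_left₀ hR0.le hRz 2))
  -- On the rectangle `[-R, R] × [0, R]` the three sides off the real line contribute at most `(2 +
  -- 1 + 1) C / R`.
  have key := integral_boundary_rect_eq_zero_of_differentiable_on_off_countable k (-R : ℂ)
    (R + R * I) s hs ?_ ?_
  · simp only [neg_re, ofReal_re, add_re, mul_re, I_re, mul_zero, ofReal_im, I_im, mul_one,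
      sub_self, add_zero, neg_im, neg_zero, add_im, mul_im, zero_add, ofReal_zero, zero_mul,
      smul_eq_mul] at key
    have e1 : ‖∫ x in (-R)..R, k (x + R * I)‖ ≤ C / R ^ 2 * |R - -R| := by
      refine intervalIntegral.norm_integral_le_of_norm_le_const fun x _ => hbR _ (by simp [hR0.le]) ?_
      have := (le_abs_self _).trans (Complex.abs_im_le_norm ((x : ℂ) + R * I))
      simpa using this
    have e2 : ‖∫ y in (0 : ℝ)..R, k (R + y * I)‖ ≤ C / R ^ 2 * |R - 0| := by
      refine intervalIntegral.norm_integral_le_of_norm_le_const fun y hy => hbR _ ?_ ?_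
      · rw [Set.uIoc_of_le hR0.le] at hy
        simpa using hy.1.le
      have := (le_abs_self _).trans (Complex.abs_re_le_norm ((R : ℂ) + y * I))
      simpa using this
    have e3 : ‖∫ y in (0 : ℝ)..R, k ((-R : ℝ) + y * I)‖ ≤ C / R ^ 2 * |R - 0| := by
      refine intervalIntegral.norm_integral_le_of_norm_le_const fun y hy => hbR _ ?_ ?_
      · rw [Set.uIoc_of_le hR0.le] at hy
        simpa using hy.1.le
      have := (neg_le_abs _).trans (Complex.abs_re_le_norm (((-R : ℝ) : ℂ) + y * I))
      simpa using this
    have e4 : ∫ x in (-R)..R, k x = (∫ x in (-R)..R, k (x + R * I)) -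
        I * (∫ y in (0 : ℝ)..R, k (R + y * I)) + I * ∫ y in (0 : ℝ)..R, k ((-R : ℝ) + y * I) := by
      linear_combination key
    rw [e4]
    have a1 : |R - -R| = 2 * R := by rw [abs_of_pos] <;> linarith
    have a2 : |R - 0| = R := by rw [sub_zero, abs_of_pos hR0]
    rw [a1] at e1
    rw [a2] at e2 e3
    have a3 : C / R ^ 2 * (2 * R) + C / R ^ 2 * R + C / R ^ 2 * R = 4 * C * R⁻¹ := by
      field_simp
      ring
    rw [← a3]
    refine (norm_add_le _ _).trans (add_le_add ((norm_sub_le _ _).trans (add_le_add e1 ?_)) ?_)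
    · simpa using e2
    · simpa using e3
  · refine hc.mono ?_
    rintro z ⟨_, hz⟩
    have hz' : z.im ∈ Set.uIcc (0 : ℝ) R := by simpa using hz
    rw [Set.uIcc_of_le hR0.le] at hz'
    exact hz'.1
  · rintro z ⟨⟨_, hz⟩, hzs⟩
    have hz' : z.im ∈ Set.Ioo (min (0 : ℝ) R) (max 0 R) := by simpa using hz
    rw [min_eq_left hR0.le] at hz'
    exact hd z hz'.1 hzs

theorem integral_im_div_normSq_sub {z : ℂ} (hz : 0 < z.im) :
    ∫ t : ℝ, z.im / normSq (t - z) = Real.pi := by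
  have h := integral_cauchyPDFReal_eq_one z.re (γ := z.im.toNNReal)
    (Real.toNNReal_pos.2 hz).ne'
  simp_rw [cauchyPDFReal_def, Real.coe_toNNReal _ hz.le] at h
  have e : ∀ t : ℝ, z.im / normSq (t - z) =
      Real.pi * (Real.pi⁻¹ * z.im * ((t - z.re) ^ 2 + z.im ^ 2)⁻¹) := by
    intro t
    have := Real.pi_ne_zero
    rw [normSq_apply]
    simp only [sub_re, ofReal_re, sub_im, ofReal_im, zero_sub]
    field_simp
  simp only [e]
  rw [integral_const_mul, h, mul_one]

theorem one_add_norm_le {z a : ℂ} (hz : 0 ≤ z.im) (ha : a.im < 0) :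
    1 + ‖z‖ ≤ (1 + (1 + ‖a‖) / -a.im) * ‖z - a‖ := by
  have h1 : -a.im ≤ ‖z - a‖ := by
    have := (le_abs_self _).trans (Complex.abs_im_le_norm (z - a))
    rw [sub_im] at this
    linarith
  have h2 : ‖z‖ ≤ ‖z - a‖ + ‖a‖ := by simpa using norm_add_le (z - a) a
  have h3 : 1 + ‖a‖ ≤ (1 + ‖a‖) / -a.im * ‖z - a‖ := by
    rw [div_mul_eq_mul_div, le_div_iff₀ (by linarith)]
    exact mul_le_mul_of_nonneg_left h1 (by positivity)
  linarith

section

variable {f : ℂ → ℂ} {C : ℝ}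

theorem norm_div_sub_le (hf : ∀ z : ℂ, 0 ≤ z.im → ‖f z‖ * (1 + ‖z‖) ≤ C)
    {z a : ℂ} (hz : 0 ≤ z.im) (ha : a.im < 0) :
    ‖f z / (z - a)‖ ≤ C * (1 + (1 + ‖a‖) / -a.im) / (1 + ‖z‖) ^ 2 := by
  have h0 : z - a ≠ 0 := by
    intro h
    have := congrArg Complex.im h
    simp at this
    linarith
  have h1 := norm_pos_iff.2 h0
  have h2 := one_add_norm_le hz ha
  have h3 := hf z hz
  have h4 : 0 ≤ C := le_trans (by positivity) h3
  rw [norm_div, div_le_div_iff₀ h1 (by positivity)]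
  calc ‖f z‖ * (1 + ‖z‖) ^ 2 = (‖f z‖ * (1 + ‖z‖)) * (1 + ‖z‖) := by ring
    _ ≤ C * ((1 + (1 + ‖a‖) / -a.im) * ‖z - a‖) :=
      mul_le_mul h3 h2 (by positivity) h4
    _ = _ := by ring

theorem integrable_inv_one_add_abs_sq : Integrable fun t : ℝ => ((1 + |t|) ^ 2)⁻¹ := by
  refine integrable_inv_one_add_sq.mono' (by fun_prop) (.of_forall fun t => ?_)
  rw [Real.norm_of_nonneg (by positivity)]
  refine inv_anti₀ (by positivity) ?_
  nlinarith [abs_nonneg t, sq_abs t]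

theorem integrable_div_sub (hc : ContinuousOn f {z | 0 ≤ z.im})
    (hf : ∀ z : ℂ, 0 ≤ z.im → ‖f z‖ * (1 + ‖z‖) ≤ C) {a : ℂ} (ha : a.im < 0) :
    Integrable fun t : ℝ => f t / (t - a) := by
  have hc' : Continuous fun t : ℝ => f t :=
    hc.comp_continuous continuous_ofReal (by simp)
  refine (integrable_inv_one_add_abs_sq.const_mul (C * (1 + (1 + ‖a‖) / -a.im))).mono' ?_
    (.of_forall fun t => ?_)
  · exact (hc'.measurable.div (by fun_prop)).aestronglyMeasurable
  · have := norm_div_sub_le hf (z := t) (by simp) ha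
    simpa [div_eq_mul_inv] using this

theorem integral_div_sub_eq_zero (hc : ContinuousOn f {z | 0 ≤ z.im})
    (hd : ∀ z : ℂ, 0 < z.im → DifferentiableAt ℂ f z)
    (hf : ∀ z : ℂ, 0 ≤ z.im → ‖f z‖ * (1 + ‖z‖) ≤ C) {a : ℂ} (ha : a.im < 0) :
    ∫ t : ℝ, f t / (t - a) = 0 := by
  have h0 : ∀ z : ℂ, 0 ≤ z.im → z - a ≠ 0 := by
    intro z hz h
    have := congrArg Complex.im h
    simp at this
    linarith
  refine integral_real_line_eq_zero (k := fun z => f z / (z - a)) Set.countable_empty ?_ ?_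
    (integrable_div_sub hc hf ha) (C := C * (1 + (1 + ‖a‖) / -a.im)) (R₀ := 1) ?_
  · exact hc.div (by fun_prop) h0
  · intro z hz _
    exact (hd z hz).div (by fun_prop) (h0 z hz.le)
  · intro z hz hz1
    have hC : 0 ≤ C := le_trans (by positivity) (hf z hz)
    have h1 : 0 ≤ 1 + (1 + ‖a‖) / -a.im := by
      have : 0 < -a.im := by linarith
      positivity
    refine (norm_div_sub_le hf hz ha).trans ?_
    gcongr
    linarith

/-- Cauchy's integral formula in the upper half-plane. -/
theorem integral_div_sub_of_im_pos (hc : ContinuousOn f {z | 0 ≤ z.im})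
    (hd : ∀ z : ℂ, 0 < z.im → DifferentiableAt ℂ f z)
    (hf : ∀ z : ℂ, 0 ≤ z.im → ‖f z‖ * (1 + ‖z‖) ≤ C) {a : ℂ} (ha : 0 < a.im) :
    (Integrable fun t : ℝ => f t / (t - a)) ∧
      ∫ t : ℝ, f t / (t - a) = 2 * Real.pi * I * f a := by
  have ha' : (starRingEnd ℂ a).im < 0 := by simpa using ha
  have hi1 : Integrable fun t : ℝ => f t / (t - a) := by
    have hc' : Continuous fun t : ℝ => f t := hc.comp_continuous continuous_ofReal (by simp)
    refine (integrable_div_sub hc hf ha').mono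
      (hc'.measurable.div (by fun_prop)).aestronglyMeasurable (.of_forall fun t => le_of_eq ?_)
    have : (t : ℂ) - starRingEnd ℂ a = starRingEnd ℂ (t - a) := by simp
    rw [norm_div, norm_div, this, RCLike.norm_conj]
  refine ⟨hi1, ?_⟩
  have hn : ∀ z : ℂ, 0 ≤ z.im → z - starRingEnd ℂ a ≠ 0 := by
    intro z hz h
    have := congrArg Complex.im h
    simp at this
    linarith
  -- A comparison function with `h a = 1` and no pole in the closed half-plane. On the real line `h
  -- t / (t - a)` is `2i` times a kernel of mass `π`, so its integral is explicit. Subtracting `f a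
  -- * h` makes the singularity at `a` removable and keeps the decay.
  set h : ℂ → ℂ := fun z => 2 * I * a.im / (z - starRingEnd ℂ a) with hh
  have ha0 : h a = 1 := by
    have e : a - starRingEnd ℂ a = 2 * I * a.im := by
      apply Complex.ext
      · simp
      · simp
        ring
    have := hn a ha.le
    rw [hh]
    simp only
    rw [← e, div_self this]
  have hhc : ContinuousOn h {z | 0 ≤ z.im} := continuousOn_const.div (by fun_prop) hn
  have hhd : ∀ z : ℂ, 0 < z.im → DifferentiableAt ℂ h z := fun z hz =>
    (differentiableAt_const _).div (by fun_prop) (hn z hz.le)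
  have hte : ∀ t : ℝ, h t / (t - a) = ((2 : ℂ) * I) * ((a.im / normSq (t - a) : ℝ) : ℂ) := by
    intro t
    rw [hh, ofReal_div, normSq_eq_conj_mul_self]
    have h1 := hn t (by simp)
    simp only [map_sub, conj_ofReal]
    rw [div_div, mul_div_assoc]
  have hint : Integrable fun t : ℝ => h t / (t - a) := by
    simp only [hte]
    have hi : Integrable fun t : ℝ => a.im / normSq (t - a) :=
      .of_integral_ne_zero (by simp [integral_im_div_normSq_sub ha])
    exact (hi.ofReal (𝕜 := ℂ)).const_mul _
  have hval : ∫ t : ℝ, h t / (t - a) = 2 * Real.pi * I := by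
    simp only [hte]
    rw [integral_const_mul, integral_complex_ofReal, integral_im_div_normSq_sub ha]
    ring
  set g : ℂ → ℂ := fun z => f z - f a * h z with hg
  have hga : g a = 0 := by simp [hg, ha0]
  have hgc : ContinuousOn g {z | 0 ≤ z.im} := hc.sub (continuousOn_const.mul hhc)
  have hgd : ∀ z : ℂ, 0 < z.im → DifferentiableAt ℂ g z := fun z hz =>
    (hd z hz).sub ((differentiableAt_const _).mul (hhd z hz))
  have hts : ∀ t : ℝ, dslope g a t = f t / (t - a) - f a * (h t / (t - a)) := by
    intro t
    have hne : (t : ℂ) ≠ a := by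
      rintro rfl
      simp at ha
    rw [dslope_of_ne _ hne, slope_def_field, hga, sub_zero, hg]
    ring
  have hzero : ∫ t : ℝ, dslope g a t = 0 := by
    set B : ℝ := 1 + (1 + ‖starRingEnd ℂ a‖) / -(starRingEnd ℂ a).im with hB
    have hB0 : 0 ≤ B := by
      have : 0 < -(starRingEnd ℂ a).im := by linarith
      positivity
    refine integral_real_line_eq_zero (Set.countable_singleton a) ?_ ?_ ?_
      (C := 2 * (C + ‖f a‖ * (2 * a.im * B))) (R₀ := 2 * ‖a‖ + 1) ?_
    · refine (continuousOn_dslope ?_).2 ⟨hgc, hgd a ha⟩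
      exact mem_of_superset (isOpen_upperHalfPlane.mem_nhds ha) fun x (hx : 0 < x.im) => hx.le
    · intro z hz hza
      exact (differentiableAt_dslope_of_ne (by simpa using hza)).2 (hgd z hz)
    · simp only [hts]
      exact hi1.sub (hint.const_mul _)
    · intro z hz hza
      have hz0 : 0 < ‖z‖ := lt_of_lt_of_le (by positivity) hza
      have hne : z ≠ a := by
        rintro rfl
        linarith [norm_nonneg z]
      have h1 : ‖z‖ / 2 ≤ ‖z - a‖ := by
        have := norm_sub_norm_le z a
        linarith
      have h2 : ‖h z‖ ≤ 2 * a.im * B / ‖z‖ := by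
        have h3 : 1 + ‖z‖ ≤ B * ‖z - starRingEnd ℂ a‖ := one_add_norm_le hz ha'
        rw [hh, norm_div, div_le_div_iff₀ (norm_pos_iff.2 (hn z hz)) hz0]
        have h4 : ‖2 * I * (a.im : ℂ)‖ = 2 * a.im := by simp [abs_of_pos ha]
        rw [h4, mul_assoc (2 * a.im)]
        exact mul_le_mul_of_nonneg_left (by linarith) (by positivity)
      have h5 : ‖f z‖ ≤ C / ‖z‖ := by
        rw [le_div_iff₀ hz0]
        nlinarith [hf z hz, norm_nonneg (f z)]
      have h6 : ‖g z‖ ≤ (C + ‖f a‖ * (2 * a.im * B)) / ‖z‖ := by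
        refine (norm_sub_le _ _).trans ?_
        rw [norm_mul, add_div, mul_div_assoc]
        exact add_le_add h5 (mul_le_mul_of_nonneg_left h2 (norm_nonneg _))
      rw [dslope_of_ne _ hne, slope_def_field, hga, sub_zero, norm_div]
      calc ‖g z‖ / ‖z - a‖ ≤ ((C + ‖f a‖ * (2 * a.im * B)) / ‖z‖) / (‖z‖ / 2) :=
            div_le_div₀ ((norm_nonneg _).trans h6) h6 (by positivity) h1
        _ = _ := by field_simp
  simp only [hts] at hzero
  rw [integral_sub hi1 (hint.const_mul _), integral_const_mul, hval, sub_eq_zero] at hzero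
  rw [hzero]
  ring

/-- The Stieltjes inversion formula for a function with continuous boundary values. -/
theorem integral_im_boundary_mul_inv_sub (hc : ContinuousOn f {z | 0 ≤ z.im})
    (hd : ∀ z : ℂ, 0 < z.im → DifferentiableAt ℂ f z)
    (hf : ∀ z : ℂ, 0 ≤ z.im → ‖f z‖ * (1 + ‖z‖) ≤ C) {a : ℂ} (ha : 0 < a.im) :
    ∫ t : ℝ, ((-(f t).im / Real.pi : ℝ) : ℂ) * (a - t)⁻¹ = f a := by
  have ha' : (starRingEnd ℂ a).im < 0 := by simpa using ha
  obtain ⟨i1, h1⟩ := integral_div_sub_of_im_pos hc hd hf ha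
  have i2 : Integrable fun t : ℝ => starRingEnd ℂ (f t / (t - starRingEnd ℂ a)) :=
    (conjCLE : ℂ →L[ℝ] ℂ).integrable_comp (integrable_div_sub hc hf ha')
  have h2 : ∫ t : ℝ, starRingEnd ℂ (f t / (t - starRingEnd ℂ a)) = 0 := by
    rw [integral_conj, integral_div_sub_eq_zero hc hd hf ha', map_zero]
  -- Write `Im f = (f - conj f) / 2i`. The conjugate part is the conjugate of an integral whose pole
  -- lies in the lower half-plane, so it vanishes.
  have e : ∀ t : ℝ, ((-(f t).im / Real.pi : ℝ) : ℂ) * (a - t)⁻¹ =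
      (2 * Real.pi * I)⁻¹ * (f t / (t - a) - starRingEnd ℂ (f t / (t - starRingEnd ℂ a))) := by
    intro t
    have hne : (t : ℂ) - a ≠ 0 := by
      intro h
      have := congrArg Complex.im h
      simp at this
      linarith
    have hne' : a - (t : ℂ) ≠ 0 := sub_ofReal_ne_zero ha t
    have hpi : (Real.pi : ℂ) ≠ 0 := ofReal_ne_zero.2 Real.pi_ne_zero
    have hI := I_ne_zero
    have h3 : f t - starRingEnd ℂ (f t) = 2 * I * (f t).im := by
      apply Complex.ext
      · simp
      · simp
        ring
    have h4 : (a - t : ℂ)⁻¹ = -(t - a : ℂ)⁻¹ := by rw [← inv_neg, neg_sub]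
    simp only [map_div₀, map_sub, conj_ofReal, conj_conj]
    rw [← sub_div, h3, h4]
    push_cast
    field_simp
  simp only [e]
  rw [integral_const_mul, integral_sub i1 i2, h1, h2, sub_zero]
  have hpi : (Real.pi : ℂ) ≠ 0 := ofReal_ne_zero.2 Real.pi_ne_zero
  field_simp

end

/-! ### The probability measure with density `Im ω(x) / π` -/

/-- The boundary density `x ↦ Im ω(x) / π` of `μ_sc ⊞ μ`. -/
noncomputable def subordinationDensity (μ : ProbabilityMeasure ℝ) (x : ℝ) : ℝ :=
  (subordination μ x).im / Real.pi

section

variable {μ : ProbabilityMeasure ℝ}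

theorem subordinationDensity_nonneg (hb : ImBoundedBelow μ) (x : ℝ) :
    0 ≤ subordinationDensity μ x :=
  div_nonneg (subordination_mem hb (by simp)).1.le Real.pi_pos.le

theorem continuous_subordinationDensity (hb : ImBoundedBelow μ) :
    Continuous (subordinationDensity μ) :=
  (Complex.continuous_im.comp ((continuousOn_subordination hb).comp_continuous
    continuous_ofReal (by simp))).div_const _

theorem sub_subordination (hb : ImBoundedBelow μ) {z : ℂ} (hz : 0 ≤ z.im) :
    z - subordination μ z = cauchyTransform μ (subordination μ z) :=
  sub_eq_of_eq_add' (subordination_add hb hz).symm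

theorem im_le_im_subordination (hb : ImBoundedBelow μ) {z : ℂ} (hz : 0 ≤ z.im) :
    z.im ≤ (subordination μ z).im := by
  have h := congrArg Complex.im (subordination_add hb hz)
  rw [add_im] at h
  linarith [im_cauchyTransform_neg μ (subordination_mem hb hz).1]

/-- With `|z| ≤ |ω| + 1`, the product is at most `2 |G(ω)| + |ω G(ω)| ≤ 2 + 2`. -/
theorem norm_sub_subordination_mul_le (hμ : IsStandardized μ) (hb : ImBoundedBelow μ) {z : ℂ}
    (hz : 0 ≤ z.im) : ‖z - subordination μ z‖ * (1 + ‖z‖) ≤ 4 := by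
  have hω := subordination_mem hb hz
  have h1 := norm_cauchyTransform_le_one μ hω.1 hω.2
  have h2 := hμ.norm_mul_cauchyTransform_le hω.1 hω.2
  have h3 : ‖z‖ ≤ ‖subordination μ z‖ + 1 := by
    calc ‖z‖ = ‖subordination μ z + cauchyTransform μ (subordination μ z)‖ := by
          rw [subordination_add hb hz]
      _ ≤ _ := (norm_add_le _ _).trans (by linarith)
  rw [sub_subordination hb hz]
  rw [norm_mul] at h2
  nlinarith [norm_nonneg (cauchyTransform μ (subordination μ z))]

theorem integral_subordinationDensity_mul_inv_sub (hμ : IsStandardized μ) (hb : ImBoundedBelow μ)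
    {z : ℂ} (hz : 0 < z.im) :
    ∫ t : ℝ, (subordinationDensity μ t : ℂ) * (z - t)⁻¹ = z - subordination μ z := by
  have h := integral_im_boundary_mul_inv_sub (f := fun z => z - subordination μ z) (C := 4)
    (continuousOn_id.sub (continuousOn_subordination hb))
    (fun z hz => differentiableAt_id.sub (differentiableAt_subordination hb hz))
    (fun z hz => norm_sub_subordination_mul_le hμ hb hz) hz
  simpa [subordinationDensity] using h

theorem tendsto_mul_sub_subordination (hμ : IsStandardized μ) (hb : ImBoundedBelow μ) :
    Tendsto (fun y : ℝ => (y * I) * (y * I - subordination μ (y * I))) atTop (𝓝 1) := by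
  rw [tendsto_iff_norm_sub_tendsto_zero]
  have h0 : Tendsto (fun y : ℝ => (y⁻¹) ^ 2 + (y⁻¹) ^ 2) atTop (𝓝 0) := by
    simpa using ((tendsto_inv_atTop_zero (𝕜 := ℝ)).pow 2).add (tendsto_inv_atTop_zero.pow 2)
  refine squeeze_zero' (.of_forall fun _ => norm_nonneg _) ?_ h0
  filter_upwards [eventually_gt_atTop 0] with y hy
  have hz : 0 ≤ (y * I : ℂ).im := by simpa using hy.le
  set ω := subordination μ (y * I) with hω
  have hmem := subordination_mem hb hz
  have hadd := subordination_add hb hz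
  have him : y ≤ ω.im := by simpa using im_le_im_subordination hb hz
  rw [sub_subordination hb hz, ← hω]
  rw [← hω] at hadd hmem
  -- Substitute `i y = ω + G(ω)`. Both summands are at most `y⁻²` because `Im ω ≥ y`.
  have e : y * I * cauchyTransform μ ω - 1 =
      (ω * cauchyTransform μ ω - 1) + cauchyTransform μ ω ^ 2 := by
    linear_combination -cauchyTransform μ ω * hadd
  rw [e]
  have h1 : (ω.im)⁻¹ ≤ y⁻¹ := inv_anti₀ hy him
  have h2 : y ≤ ‖ω‖ := him.trans ((le_abs_self _).trans (Complex.abs_im_le_norm ω))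
  refine (norm_add_le _ _).trans (add_le_add ?_ ?_)
  · refine (hμ.norm_mul_cauchyTransform_sub_one_le hmem.1).trans ?_
    rw [inv_pow, sq]
    exact inv_anti₀ (by positivity) (mul_le_mul h2 him hy.le (norm_nonneg _))
  · rw [norm_pow]
    exact pow_le_pow_left₀ (norm_nonneg _) ((norm_cauchyTransform_le μ hmem.1).trans h1) 2

/-- The mass is the limit of `i y` times the Cauchy transform at `i y`; the density dominates the
integrand since `|i y / (i y - t)| ≤ 1`. -/
theorem integral_subordinationDensity (hμ : IsStandardized μ) (hb : ImBoundedBelow μ)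
    (hi : Integrable (subordinationDensity μ)) : ∫ t, subordinationDensity μ t = 1 := by
  have h1 := tendsto_mul_sub_subordination hμ hb
  have h2 : Tendsto (fun y : ℝ => ∫ t : ℝ, (subordinationDensity μ t : ℂ) *
      (y * I * (y * I - t)⁻¹)) atTop (𝓝 (∫ t : ℝ, (subordinationDensity μ t : ℂ))) := by
    refine tendsto_integral_filter_of_dominated_convergence (subordinationDensity μ)
      (.of_forall fun y => ?_) ?_ hi (.of_forall fun t => ?_)
    · have := (continuous_subordinationDensity hb).measurable
      fun_prop
    · filter_upwards [eventually_gt_atTop 0] with y hy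
      refine .of_forall fun t => ?_
      have h3 : ‖(y * I - t : ℂ)⁻¹‖ ≤ y⁻¹ := by
        have := norm_inv_sub_ofReal_le (w := y * I) (by simpa using hy) t
        simpa using this
      rw [norm_mul, norm_mul, norm_real, Real.norm_of_nonneg (subordinationDensity_nonneg hb t)]
      have h4 : ‖(y * I : ℂ)‖ = y := by simp [abs_of_pos hy]
      rw [h4]
      refine mul_le_of_le_one_right (subordinationDensity_nonneg hb t) ?_
      calc y * ‖(y * I - t : ℂ)⁻¹‖ ≤ y * y⁻¹ := mul_le_mul_of_nonneg_left h3 hy.le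
        _ = 1 := mul_inv_cancel₀ hy.ne'
    · have h5 : Tendsto (fun y : ℝ => (subordinationDensity μ t : ℂ) *
          (1 - t * I⁻¹ * ((y⁻¹ : ℝ) : ℂ))⁻¹) atTop (𝓝 (subordinationDensity μ t)) := by
        have h6 : Tendsto (fun y : ℝ => ((y⁻¹ : ℝ) : ℂ)) atTop (𝓝 0) := by
          rw [← ofReal_zero]
          exact (continuous_ofReal.tendsto 0).comp tendsto_inv_atTop_zero
        have h7 : Tendsto (fun y : ℝ => 1 - t * I⁻¹ * ((y⁻¹ : ℝ) : ℂ)) atTop (𝓝 1) := by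
          simpa using (h6.const_mul (t * I⁻¹ : ℂ)).const_sub 1
        simpa using (h7.inv₀ one_ne_zero).const_mul (subordinationDensity μ t : ℂ)
      refine h5.congr' ?_
      filter_upwards [eventually_gt_atTop 0] with y hy
      congr 1
      have hy' : (y : ℂ) ≠ 0 := ofReal_ne_zero.2 hy.ne'
      have hI := I_ne_zero
      have h8 : (y * I - t : ℂ) ≠ 0 := sub_ofReal_ne_zero (w := y * I) (by simpa using hy) t
      have h9 : 1 - t * I⁻¹ * ((y⁻¹ : ℝ) : ℂ) = (y * I - t) * (y * I)⁻¹ := by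
        push_cast
        field_simp
      rw [h9, mul_inv, inv_inv, mul_comm]
  have h3 : (fun y : ℝ => ∫ t : ℝ, (subordinationDensity μ t : ℂ) * (y * I * (y * I - t)⁻¹))
      =ᶠ[atTop] fun y : ℝ => (y * I) * (y * I - subordination μ (y * I)) := by
    filter_upwards [eventually_gt_atTop 0] with y hy
    rw [← integral_subordinationDensity_mul_inv_sub hμ hb (by simpa using hy),
      ← integral_const_mul]
    congr 1 with t
    ring
  have h4 := tendsto_nhds_unique (h2.congr' h3) h1
  rw [integral_complex_ofReal] at h4
  exact_mod_cast h4

/-- The probability measure with Cauchy transform `z - ω(z)`. -/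
theorem exists_probabilityMeasure_cauchyTransform_eq (hμ : IsStandardized μ)
    (hb : ImBoundedBelow μ) (hi : Integrable (subordinationDensity μ)) :
    ∃ ρ : ProbabilityMeasure ℝ,
      (ρ : Measure ℝ) = volume.withDensity
        (fun x => ENNReal.ofReal (subordinationDensity μ x)) ∧
      ∀ z : ℂ, 0 < z.im → cauchyTransform ρ z = z - subordination μ z := by
  have hprob : IsProbabilityMeasure
      (volume.withDensity fun x => ENNReal.ofReal (subordinationDensity μ x)) := by
    constructor
    rw [withDensity_apply _ MeasurableSet.univ, Measure.restrict_univ,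
      ← ofReal_integral_eq_lintegral_ofReal hi (.of_forall (subordinationDensity_nonneg hb)),
      integral_subordinationDensity hμ hb hi, ENNReal.ofReal_one]
  refine ⟨⟨_, hprob⟩, rfl, fun z hz => ?_⟩
  rw [← integral_subordinationDensity_mul_inv_sub hμ hb hz]
  change ∫ x : ℝ, (z - (x : ℂ))⁻¹ ∂(volume.withDensity fun x =>
    ENNReal.ofReal (subordinationDensity μ x)) = _
  rw [integral_withDensity_eq_integral_toReal_smul
    (continuous_subordinationDensity hb).measurable.ennreal_ofReal (by simp)]
  congr 1 with t
  rw [ENNReal.toReal_ofReal (subordinationDensity_nonneg hb t), real_smul]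

end

/-! ### Gaussian estimates -/

theorem isStandardized_gaussianLaw : IsStandardized gaussianLaw where
  memLp := memLp_id_gaussianReal 2
  mean := integral_id_gaussianReal
  variance := by
    have h := variance_fun_id_gaussianReal (μ := 0) (v := 1)
    rw [variance_eq_integral (by fun_prop)] at h
    simpa [gaussianLaw] using h

theorem gaussianPDFReal_standard (x : ℝ) :
    gaussianPDFReal 0 1 x = (√(2 * Real.pi))⁻¹ * Real.exp (-x ^ 2 / 2) := by
  simp [gaussianPDFReal]

theorem gaussianPDFReal_standard_le_of_sq_le {x y c : ℝ} (h : y ^ 2 ≤ x ^ 2 + 2 * c) :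
    gaussianPDFReal 0 1 x ≤ Real.exp c * gaussianPDFReal 0 1 y := by
  rw [gaussianPDFReal_standard, gaussianPDFReal_standard, mul_left_comm, ← Real.exp_add]
  gcongr
  linarith

theorem sqResolvent_gaussianLaw (w : ℂ) :
    sqResolvent gaussianLaw w = ∫ s : ℝ, gaussianPDFReal 0 1 s * (normSq (w - s))⁻¹ := by
  rw [sqResolvent]
  exact integral_gaussianReal_eq_integral_smul one_ne_zero

theorem integrable_gaussianReal_iff (f : ℝ → ℝ) :
    Integrable f (gaussianReal 0 1) ↔ Integrable fun s => gaussianPDFReal 0 1 s * f s := by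
  rw [gaussianReal_of_var_ne_zero _ one_ne_zero,
    integrable_withDensity_iff_integrable_smul' (measurable_gaussianPDF 0 1)
      (.of_forall fun _ => gaussianPDF_lt_top)]
  simp [toReal_gaussianPDF]

/-- With `v = Im w < 1`, on `|s - Re w| ≤ v` the density is at least `c` and the kernel at least `1
/ (2 v²)`. Hence `c / v ≤ sqResolvent ≤ 1`, that is, `v ≥ c`. -/
theorem imBoundedBelow_gaussianLaw : ImBoundedBelow gaussianLaw := by
  intro R
  set c := gaussianPDFReal 0 1 (|R| + 1) with hc
  have hc0 : 0 < c := gaussianPDFReal_pos 0 1 _ one_ne_zero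
  refine ⟨min 1 c, lt_min one_pos hc0, fun w hw hwR => ?_⟩
  obtain ⟨hw0, hw1⟩ := hw
  rcases le_or_gt 1 w.im with h1 | h1
  · exact (min_le_left _ _).trans h1
  refine (min_le_right _ _).trans ?_
  set v := w.im
  have hi : Integrable fun s : ℝ => gaussianPDFReal 0 1 s * (normSq (w - s))⁻¹ :=
    (integrable_gaussianReal_iff _).1 (integrable_inv_normSq_sub gaussianLaw hw0)
  have hpt : ∀ s ∈ Set.Icc (w.re - v) (w.re + v),
      c * (2 * v ^ 2)⁻¹ ≤ gaussianPDFReal 0 1 s * (normSq (w - s))⁻¹ := by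
    rintro s ⟨hs1, hs2⟩
    have hre := (Complex.abs_re_le_norm w).trans (hwR.trans (le_abs_self R))
    rw [abs_le] at hre
    have hs : s ^ 2 ≤ (|R| + 1) ^ 2 := by
      rw [sq_le_sq, abs_of_pos (show 0 < |R| + 1 by positivity), abs_le]
      constructor <;> linarith
    have h2 : c ≤ gaussianPDFReal 0 1 s := by
      have := gaussianPDFReal_standard_le_of_sq_le (x := |R| + 1) (y := s) (c := 0) (by linarith)
      simpa using this
    refine mul_le_mul h2 (inv_anti₀ ?_ ?_) (by positivity) (gaussianPDFReal_nonneg _ _ _)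
    · exact normSq_pos.2 (sub_ofReal_ne_zero hw0 s)
    · rw [normSq_apply]
      simp only [sub_re, ofReal_re, sub_im, ofReal_im, sub_zero]
      change (w.re - s) * (w.re - s) + v * v ≤ 2 * v ^ 2
      nlinarith
  have h3 := setIntegral_mono_on (μ := volume) (s := Set.Icc (w.re - v) (w.re + v))
    (integrable_const (c * (2 * v ^ 2)⁻¹)) hi.integrableOn measurableSet_Icc hpt
  have h4 := setIntegral_le_integral (s := Set.Icc (w.re - v) (w.re + v)) hi
    (.of_forall fun s => mul_nonneg (gaussianPDFReal_nonneg _ _ _) (inv_nonneg.2 (normSq_nonneg _)))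
  rw [← sqResolvent_gaussianLaw] at h4
  have h5 := (h3.trans h4).trans hw1
  rw [setIntegral_const, Real.volume_real_Icc_of_le (by linarith), smul_eq_mul] at h5
  have h6 : (w.re + v - (w.re - v)) * (c * (2 * v ^ 2)⁻¹) = c / v := by
    have := hw0.ne'
    field_simp
    ring
  rwa [h6, div_le_one hw0] at h5

/-- Let `u = Re w`. If `|u - s| ≥ |u| / 2`, the term `4 / u²` suffices. Otherwise `|u| ≤ 2 |s|`, and
the hypothesis gives `(u - s)⁻² ≤ u² = u⁴ / u² ≤ 16 s⁴ / u²`. -/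
theorem inv_normSq_sub_le {w : ℂ} {s : ℝ} (hu : w.re ≠ 0)
    (hs : 1 ≤ |w.re| * |w.re - s|) :
    (normSq (w - s))⁻¹ ≤ (4 + 16 * s ^ 4) / w.re ^ 2 := by
  have hu0 : 0 < |w.re| := abs_pos.2 hu
  have hd0 : 0 < |w.re - s| := by
    by_contra h
    have : |w.re - s| = 0 := le_antisymm (not_lt.1 h) (abs_nonneg _)
    rw [this] at hs
    linarith
  have h1 : (w.re - s) ^ 2 ≤ normSq (w - s) := by
    rw [normSq_apply]
    simp only [sub_re, ofReal_re, sub_im, ofReal_im, sub_zero]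
    nlinarith
  have h2 : 0 < (w.re - s) ^ 2 := by rw [← sq_abs]; positivity
  have h3 : 0 < w.re ^ 2 := by positivity
  refine (inv_anti₀ h2 h1).trans ?_
  rw [inv_eq_one_div, div_le_div_iff₀ h2 h3, one_mul, ← sq_abs w.re, ← sq_abs (w.re - s)]
  have h4 : |w.re| ≤ |w.re - s| + |s| := by simpa using abs_add_le (w.re - s) s
  have h5 : s ^ 4 = |s| ^ 4 := by rw [← abs_pow, abs_of_nonneg (by positivity)]
  rw [h5]
  set a := |w.re|
  set d := |w.re - s|
  have hs0 := abs_nonneg s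
  rcases le_or_gt a (2 * d) with h | h
  · have : a ^ 2 ≤ (2 * d) ^ 2 := pow_le_pow_left₀ hu0.le h 2
    nlinarith [mul_nonneg (pow_nonneg hs0 4) (sq_nonneg d)]
  · have h6 : a ≤ 2 * |s| := by linarith
    have h7 : a ^ 4 ≤ (2 * |s|) ^ 4 := pow_le_pow_left₀ hu0.le h6 4
    have h8 : 1 ≤ (a * d) ^ 2 := one_le_pow₀ hs
    have h9 : a ^ 2 ≤ a ^ 2 * (a * d) ^ 2 := le_mul_of_one_le_right (by positivity) h8
    have h10 : a ^ 4 * d ^ 2 ≤ (2 * |s|) ^ 4 * d ^ 2 := mul_le_mul_of_nonneg_right h7 (by positivity)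
    nlinarith [sq_nonneg d]

/-- Because `u² - s² = 2u (u - s) - (u - s)² ≤ 2`: on the scale `1 / |u|` the Gaussian density
varies by a bounded factor. -/
theorem gaussianPDFReal_standard_le_of_mul_le_one {u s : ℝ} (h : |u| * |u - s| ≤ 1) :
    gaussianPDFReal 0 1 s ≤ Real.exp 1 * gaussianPDFReal 0 1 u := by
  refine gaussianPDFReal_standard_le_of_sq_le ?_
  rw [← abs_mul] at h
  nlinarith [(le_abs_self _).trans h, sq_nonneg (u - s)]

theorem integrable_pow_four_gaussianReal : Integrable (fun s : ℝ => s ^ 4) (gaussianReal 0 1) := by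
  have h := (memLp_id_gaussianReal (μ := 0) (v := 1) 4).integrable_norm_pow (by norm_num)
  refine h.congr (.of_forall fun s => ?_)
  simp only [id, Real.norm_eq_abs]
  rw [← abs_pow, abs_of_nonneg (by positivity)]

/-- Split at `|u| |u - s| = 1` with `u = Re w`. Near `u` the density is comparable to its value at
`u`, and the kernel has mass `π`. Far from `u` a fourth moment suffices, since that term keeps the
factor `Im w` and can be absorbed. -/
theorem im_mul_sqResolvent_gaussianLaw_le {w : ℂ} (hw : 0 < w.im) (hu : w.re ≠ 0) :
    w.im * sqResolvent gaussianLaw w ≤ Real.exp 1 * Real.pi * gaussianPDFReal 0 1 w.re +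
      w.im * ((4 + 16 * ∫ s, s ^ 4 ∂(gaussianReal 0 1)) / w.re ^ 2) := by
  have hi : Integrable fun s : ℝ => gaussianPDFReal 0 1 s * (normSq (w - s))⁻¹ :=
    (integrable_gaussianReal_iff _).1 (integrable_inv_normSq_sub gaussianLaw hw)
  have hk : Integrable fun s : ℝ => w.im / normSq (s - w) :=
    .of_integral_ne_zero (by simp [integral_im_div_normSq_sub hw])
  have hm' : Integrable (fun s : ℝ => (4 + 16 * s ^ 4) / w.re ^ 2) (gaussianReal 0 1) :=
    ((integrable_const _).add (integrable_pow_four_gaussianReal.const_mul 16)).div_const _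
  have hm := (integrable_gaussianReal_iff _).1 hm'
  have hmv : ∫ s, gaussianPDFReal 0 1 s * ((4 + 16 * s ^ 4) / w.re ^ 2) =
      (4 + 16 * ∫ s, s ^ 4 ∂(gaussianReal 0 1)) / w.re ^ 2 := by
    have h := integral_gaussianReal_eq_integral_smul (μ := 0) (v := 1) one_ne_zero
      (f := fun s : ℝ => (4 + 16 * s ^ 4) / w.re ^ 2)
    simp only [smul_eq_mul] at h
    rw [← h, integral_div, integral_add (integrable_const _)
      (integrable_pow_four_gaussianReal.const_mul 16), integral_const_mul]
    simp
  have hle : ∫ s : ℝ, w.im * (gaussianPDFReal 0 1 s * (normSq (w - s))⁻¹) ≤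
      ∫ s : ℝ, (Real.exp 1 * gaussianPDFReal 0 1 w.re * (w.im / normSq (s - w)) +
        w.im * (gaussianPDFReal 0 1 s * ((4 + 16 * s ^ 4) / w.re ^ 2))) := by
    refine integral_mono (hi.const_mul _) ((hk.const_mul _).add (hm.const_mul _)) fun s => ?_
    have hn : normSq ((s : ℂ) - w) = normSq (w - s) := by rw [← normSq_neg, neg_sub]
    have hg := gaussianPDFReal_nonneg 0 1 s
    have hg' := gaussianPDFReal_nonneg 0 1 w.re
    have hN := inv_nonneg.2 (normSq_nonneg (w - s))
    simp only [hn, div_eq_mul_inv w.im]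
    rcases le_total (|w.re| * |w.re - s|) 1 with h | h
    · have h1 := gaussianPDFReal_standard_le_of_mul_le_one h
      have h2 := mul_le_mul_of_nonneg_right h1 (mul_nonneg hw.le hN)
      have h3 : 0 ≤ w.im * (gaussianPDFReal 0 1 s * ((4 + 16 * s ^ 4) / w.re ^ 2)) := by positivity
      linarith
    · have h1 := inv_normSq_sub_le hu h
      have h2 := mul_le_mul_of_nonneg_left (mul_le_mul_of_nonneg_left h1 hg) hw.le
      have h3 : 0 ≤ Real.exp 1 * gaussianPDFReal 0 1 w.re * (w.im * (normSq (w - s))⁻¹) := by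
        positivity
      linarith
  rw [integral_add (hk.const_mul _) (hm.const_mul _), integral_const_mul, integral_const_mul,
    integral_const_mul, hmv, integral_im_div_normSq_sub hw, ← sqResolvent_gaussianLaw] at hle
  linarith

/-- For `(Re w)² > 2K` the far term in the previous estimate is at most `Im w / 2` and moves to the
left. For smaller `Re w`, `Im w ≤ 1` and the constant `exp K` compensates for the exponential. -/
theorem exists_im_le_mul_exp : ∃ C > 0, ∀ w : ℂ, 0 < w.im → sqResolvent gaussianLaw w = 1 →
    w.im ≤ C * Real.exp (-w.re ^ 2 / 2) := by
  set K := 4 + 16 * ∫ s, s ^ 4 ∂(gaussianReal 0 1) with hK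
  have hK0 : 0 < K := by
    have : 0 ≤ ∫ s, s ^ 4 ∂(gaussianReal 0 1) := integral_nonneg fun s => by positivity
    positivity
  set A := 2 * Real.exp 1 * Real.pi * (√(2 * Real.pi))⁻¹ with hA
  have hpi := Real.pi_pos
  have hA0 : 0 < A := by positivity
  refine ⟨max A (Real.exp K), lt_max_of_lt_left hA0, fun w hw h1 => ?_⟩
  have hE := Real.exp_pos (-w.re ^ 2 / 2)
  rcases le_or_gt (w.re ^ 2) (2 * K) with h | h
  · have h2 := sqResolvent_le gaussianLaw hw
    rw [h1, inv_pow] at h2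
    have h3 : w.im ^ 2 ≤ 1 := by
      have := (one_le_inv₀ (by positivity)).1 h2
      exact this
    have h4 : w.im ≤ 1 := by nlinarith
    refine h4.trans (le_trans ?_ (mul_le_mul_of_nonneg_right (le_max_right _ _) hE.le))
    rw [← Real.exp_add, Real.one_le_exp_iff]
    linarith
  · have hu : w.re ≠ 0 := by
      intro h0
      rw [h0] at h
      linarith [show (0 : ℝ) ^ 2 = 0 by norm_num]
    have h2 := im_mul_sqResolvent_gaussianLaw_le hw hu
    rw [h1, mul_one, ← hK, gaussianPDFReal_standard] at h2
    have h3 : K / w.re ^ 2 ≤ 1 / 2 := by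
      rw [div_le_div_iff₀ (by positivity) (by norm_num)]
      linarith
    have h4 := mul_le_mul_of_nonneg_left h3 hw.le
    refine le_trans ?_ (mul_le_mul_of_nonneg_right (le_max_left _ _) hE.le)
    rw [hA]
    linarith

theorem sqResolvent_subordination_ofReal {μ : ProbabilityMeasure ℝ} (hb : ImBoundedBelow μ)
    (x : ℝ) : sqResolvent μ (subordination μ x) = 1 := by
  have hω := subordination_mem hb (z := x) (by simp)
  have h := im_add_cauchyTransform μ hω.1
  rw [subordination_add hb (by simp), ofReal_im, zero_eq_mul] at h
  rcases h with h | h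
  · exact absurd h hω.1.ne'
  · linarith

/-- Square `x = Re ω + Re G(ω)`: the cross term is at most `2 * 2` since `|ω G(ω)| ≤ 2`, and the
last square at most `1`. A bound on `|x - Re ω|` alone would not preserve the Gaussian rate. -/
theorem sq_le_re_subordination_sq_add {μ : ProbabilityMeasure ℝ} (hμ : IsStandardized μ)
    (hb : ImBoundedBelow μ) (x : ℝ) : x ^ 2 ≤ (subordination μ x).re ^ 2 + 5 := by
  have hω := subordination_mem hb (z := x) (by simp)
  have h0 := congrArg Complex.re (subordination_add hb (z := x) (by simp))
  set ω := subordination μ x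
  rw [add_re, ofReal_re] at h0
  have h1 := (Complex.abs_re_le_norm _).trans (norm_cauchyTransform_le_one μ hω.1 hω.2)
  have h2 := hμ.norm_mul_cauchyTransform_le hω.1 hω.2
  have h3 : |ω.re * (cauchyTransform μ ω).re| ≤ 2 := by
    refine le_trans ?_ h2
    rw [abs_mul, norm_mul]
    exact mul_le_mul (Complex.abs_re_le_norm _) (Complex.abs_re_le_norm _) (abs_nonneg _)
      (norm_nonneg _)
  have h4 : (cauchyTransform μ ω).re ^ 2 ≤ 1 := (sq_le_one_iff_abs_le_one _).2 h1
  rw [← h0]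
  nlinarith [(le_abs_self _).trans h3]

theorem exists_subordinationDensity_gaussianLaw_le : ∃ C > 0, ∀ x : ℝ,
    subordinationDensity gaussianLaw x ≤ C * Real.exp (-x ^ 2 / 2) := by
  obtain ⟨C, hC, h⟩ := exists_im_le_mul_exp
  refine ⟨C * Real.exp (5 / 2) / Real.pi, by positivity, fun x => ?_⟩
  have hb := imBoundedBelow_gaussianLaw
  have h1 := h _ (subordination_mem hb (z := x) (by simp)).1 (sqResolvent_subordination_ofReal hb x)
  have h2 := sq_le_re_subordination_sq_add isStandardized_gaussianLaw hb x
  rw [subordinationDensity, div_mul_eq_mul_div]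
  refine div_le_div_of_nonneg_right (h1.trans ?_) Real.pi_pos.le
  rw [mul_assoc, ← Real.exp_add]
  gcongr
  linarith

theorem integrable_subordinationDensity_gaussianLaw :
    Integrable (subordinationDensity gaussianLaw) := by
  obtain ⟨C, -, h⟩ := exists_subordinationDensity_gaussianLaw_le
  have hi : Integrable fun x : ℝ => C * Real.exp (-x ^ 2 / 2) := by
    refine ((integrable_exp_neg_mul_sq (b := 1 / 2) (by norm_num)).const_mul C).congr
      (.of_forall fun x => ?_)
    simp only
    congr 2
    ring
  refine hi.mono' (continuous_subordinationDensity imBoundedBelow_gaussianLaw).aestronglyMeasurable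
    (.of_forall fun x => ?_)
  rw [Real.norm_of_nonneg (subordinationDensity_nonneg imBoundedBelow_gaussianLaw x)]
  exact h x

/-! ### Inverting `F_μ` and constructing Voiculescu transforms -/

theorem isOpen_setOf_lt_im (β : ℝ) : IsOpen {z : ℂ | β < z.im} :=
  isOpen_lt continuous_const Complex.continuous_im

theorem IsVoiculescuTransform.of_norm_le {μ : ProbabilityMeasure ℝ} {α β C : ℝ} {φ : ℂ → ℂ}
    (hd : DifferentiableOn ℂ φ {w | β < w.im}) (hb : ∀ w : ℂ, β < w.im → ‖φ w‖ ≤ C)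
    (hi : ∀ w : ℂ, β < w.im → 0 < (w + φ w).im)
    (hF : ∀ w : ℂ, β < w.im → cauchyTransform μ (w + φ w) = w⁻¹) :
    IsVoiculescuTransform μ α β φ where
  analytic := hd.mono fun _ hw => hw.2
  im_pos w hw := hi w hw.2
  right_inverse w hw := by rw [reciprocalCauchyTransform, hF w hw.2, inv_inv]
  isLittleO := by
    have h1 : φ =O[Bornology.cobounded ℂ ⊓ 𝓟 (truncatedCone α β)] fun _ => (1 : ℂ) := by
      refine Asymptotics.IsBigO.of_bound C ?_
      filter_upwards [mem_inf_of_right (mem_principal_self _)] with w hw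
      simpa using hb w hw.2
    exact h1.trans_isLittleO
      ((Asymptotics.isLittleO_const_id_cobounded (1 : ℂ)).mono inf_le_left)

section

variable {μ : ProbabilityMeasure ℝ}

theorem IsStandardized.norm_reciprocalCauchyTransform_sub_le (hμ : IsStandardized μ) {z : ℂ}
    (hz : 2 ≤ z.im) : ‖reciprocalCauchyTransform μ z - z‖ ≤ 2 / z.im := by
  have hz0 : 0 < z.im := by linarith
  have h0 := cauchyTransform_ne_zero μ hz0
  have hn : z.im ≤ ‖z‖ := (le_abs_self _).trans (Complex.abs_im_le_norm z)
  have hn0 : 0 < ‖z‖ := hz0.trans_le hn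
  have h1 := hμ.norm_mul_cauchyTransform_sub_one_le hz0
  have h2 : (‖z‖ * z.im)⁻¹ ≤ 1 / 2 := by
    rw [inv_eq_one_div, div_le_div_iff₀ (by positivity) (by norm_num)]
    nlinarith
  have h3 : 1 / 2 ≤ ‖z * cauchyTransform μ z‖ := by
    have := norm_sub_norm_le 1 (1 - z * cauchyTransform μ z)
    rw [sub_sub_cancel, norm_one, norm_sub_rev] at this
    linarith
  have e : reciprocalCauchyTransform μ z - z =
      -(z * cauchyTransform μ z - 1) / cauchyTransform μ z := by
    rw [reciprocalCauchyTransform]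
    field_simp
    ring
  rw [norm_mul] at h3
  have hG : 0 < ‖cauchyTransform μ z‖ := norm_pos_iff.2 h0
  rw [e, norm_div, norm_neg, div_le_div_iff₀ hG hz0]
  calc ‖z * cauchyTransform μ z - 1‖ * z.im ≤ (‖z‖ * z.im)⁻¹ * z.im :=
        mul_le_mul_of_nonneg_right h1 hz0.le
    _ = ‖z‖⁻¹ := by field_simp
    _ ≤ 2 * ‖cauchyTransform μ z‖ := by
      rw [inv_le_iff_one_le_mul₀ hn0]
      linarith

theorem differentiableAt_reciprocalCauchyTransform {z : ℂ} (hz : 0 < z.im) :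
    DifferentiableAt ℂ (reciprocalCauchyTransform μ) z :=
  (hasDerivAt_cauchyTransform μ hz).differentiableAt.inv (cauchyTransform_ne_zero μ hz)

/-- Cauchy's estimate on the disc of radius `2`, which stays in `Im ≥ 2`, where `|F_μ(z) - z| ≤ 1`.
-/
theorem IsStandardized.norm_deriv_sub_reciprocalCauchyTransform_le (hμ : IsStandardized μ) {z : ℂ}
    (hz : 4 ≤ z.im) : ‖deriv (fun z => z - reciprocalCauchyTransform μ z) z‖ ≤ 1 / 2 := by
  have him : ∀ x ∈ Metric.closedBall z 2, 2 ≤ x.im := by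
    intro x hx
    rw [mem_closedBall_iff_norm'] at hx
    have := (le_abs_self _).trans ((Complex.abs_im_le_norm (z - x)).trans hx)
    rw [sub_im] at this
    linarith
  refine Complex.norm_deriv_le_of_forall_mem_sphere_norm_le two_pos ?_ fun x hx => ?_
  · refine DifferentiableOn.diffContOnCl fun x hx => ?_
    rw [closure_ball z two_ne_zero] at hx
    exact (differentiableAt_id.sub (differentiableAt_reciprocalCauchyTransform
      (by linarith [him x hx]))).differentiableWithinAt
  · have h := him x (Metric.sphere_subset_closedBall hx)
    rw [norm_sub_rev]
    refine (hμ.norm_reciprocalCauchyTransform_sub_le h).trans ?_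
    rw [div_le_one (by linarith)]
    exact h

theorem IsStandardized.norm_sub_reciprocalCauchyTransform_sub_le (hμ : IsStandardized μ) {z z' : ℂ}
    (hz : 4 ≤ z.im) (hz' : 4 ≤ z'.im) :
    ‖(z - reciprocalCauchyTransform μ z) - (z' - reciprocalCauchyTransform μ z')‖ ≤
      1 / 2 * ‖z - z'‖ :=
  (convex_halfSpace_im_ge 4).norm_image_sub_le_of_norm_deriv_le
    (f := fun z => z - reciprocalCauchyTransform μ z)
    (fun x (hx : 4 ≤ x.im) => differentiableAt_id.sub
      (differentiableAt_reciprocalCauchyTransform (by linarith)))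
    (fun _ hx => hμ.norm_deriv_sub_reciprocalCauchyTransform_le hx) hz' hz

/-- Banach's fixed point theorem for `z ↦ w + (z - F_μ(z))` on `Im z ≥ 4`: the displacement from `w`
is at most `1`, so `Im w ≥ 5` keeps the half-plane invariant. -/
theorem IsStandardized.exists_reciprocalCauchyTransform_eq (hμ : IsStandardized μ) {w : ℂ}
    (hw : 5 ≤ w.im) :
    ∃ z : ℂ, 4 ≤ z.im ∧ reciprocalCauchyTransform μ z = w ∧ ‖z - w‖ ≤ 1 := by
  set T : ℂ → ℂ := fun z => w + (z - reciprocalCauchyTransform μ z) with hT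
  have hK : ∀ z : ℂ, 4 ≤ z.im → ‖z - reciprocalCauchyTransform μ z‖ ≤ 1 := by
    intro z hz
    rw [norm_sub_rev]
    refine (hμ.norm_reciprocalCauchyTransform_sub_le (by linarith)).trans ?_
    rw [div_le_one (by linarith)]
    linarith
  have hmaps : Set.MapsTo T {z | 4 ≤ z.im} {z | 4 ≤ z.im} := by
    intro z hz
    have h1 := (abs_le.1 ((Complex.abs_im_le_norm _).trans (hK z hz))).1
    change 4 ≤ (w + (z - reciprocalCauchyTransform μ z)).im
    rw [add_im]
    linarith
  have hcomplete : IsComplete {z : ℂ | 4 ≤ z.im} :=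
    (isClosed_le continuous_const Complex.continuous_im).isComplete
  have hcontr : ContractingWith (1 / 2) (hmaps.restrict T _ _) := by
    refine ⟨by norm_num, LipschitzWith.of_dist_le_mul fun x y => ?_⟩
    rw [Subtype.dist_eq, Subtype.dist_eq, dist_eq_norm, dist_eq_norm]
    simp only [Set.MapsTo.val_restrict_apply, hT, add_sub_add_left_eq_sub]
    simpa using hμ.norm_sub_reciprocalCauchyTransform_sub_le x.2 y.2
  obtain ⟨z, hz, hfix, -⟩ := hcontr.exists_fixedPoint' hcomplete hmaps (x := w)
    (show 4 ≤ w.im by linarith) (edist_ne_top _ _)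
  have hfix' : w + (z - reciprocalCauchyTransform μ z) = z := hfix
  have h2 : reciprocalCauchyTransform μ z = w := by linear_combination -hfix'
  refine ⟨z, hz, h2, ?_⟩
  have := hK z hz
  rwa [h2] at this

/-- The inverse of `F_μ` on a half-plane. -/
theorem IsStandardized.exists_inverse (hμ : IsStandardized μ) :
    ∃ g : ℂ → ℂ, DifferentiableOn ℂ g {w | 5 < w.im} ∧
      ∀ w : ℂ, 5 < w.im → 4 ≤ (g w).im ∧ cauchyTransform μ (g w) = w⁻¹ ∧ ‖g w - w‖ ≤ 1 := by
  choose! g hg1 hg2 hg3 using fun w (hw : 5 < w.im) =>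
    hμ.exists_reciprocalCauchyTransform_eq (w := w) hw.le
  refine ⟨g, fun w hw => ?_, fun w hw => ⟨hg1 w hw, ?_, hg3 w hw⟩⟩
  · have hmem : {w : ℂ | 5 < w.im} ∈ 𝓝 w := (isOpen_setOf_lt_im 5).mem_nhds hw
    -- The contraction estimate bounds the variation of `g - id` by half that of `g`; absorbing it
    -- gives the constant `2`.
    have hlip : LipschitzOnWith 2 g {w | 5 < w.im} := by
      refine LipschitzOnWith.of_dist_le_mul fun x hx y hy => ?_
      have h1 := hμ.norm_sub_reciprocalCauchyTransform_sub_le (hg1 x hx) (hg1 y hy)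
      rw [hg2 x hx, hg2 y hy] at h1
      have h2 : g x - g y = (g x - x - (g y - y)) + (x - y) := by ring
      have h3 : ‖g x - g y‖ ≤ ‖g x - x - (g y - y)‖ + ‖x - y‖ := by
        conv_lhs => rw [h2]
        exact norm_add_le _ _
      rw [dist_eq_norm, dist_eq_norm, NNReal.coe_ofNat]
      linarith
    have h4 : (4 : ℝ) ≤ (g w).im := hg1 w hw
    have hF := (differentiableAt_reciprocalCauchyTransform (μ := μ)
      (z := g w) (by linarith)).hasDerivAt
    refine (hF.of_local_left_inverse (hlip.continuousOn.continuousAt hmem) ?_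
      ?_).differentiableAt.differentiableWithinAt
    · intro h0
      have h5 := hμ.norm_deriv_sub_reciprocalCauchyTransform_le h4
      rw [h0] at hF
      have h6 := ((hasDerivAt_id (g w)).sub hF).deriv
      have h7 : deriv (fun z => z - reciprocalCauchyTransform μ z) (g w) = 1 - 0 := h6
      rw [h7] at h5
      norm_num at h5
    · filter_upwards [hmem] with x hx using hg2 x hx
  · have := hg2 w hw
    rw [reciprocalCauchyTransform] at this
    rw [← inv_inv (cauchyTransform μ (g w)), this]

end

/-- If `F_μ` has the inverse `g`, then the semicircle law added to `μ` by subordination has the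
Voiculescu transform `w ↦ w⁻¹ + (g w - w)`. -/
theorem isVoiculescuTransform_of_cauchyTransform_eq_sub_subordination
    {μ ρ : ProbabilityMeasure ℝ} {α : ℝ} {g : ℂ → ℂ}
    (hρ : ∀ z : ℂ, 0 < z.im → cauchyTransform ρ z = z - subordination μ z)
    (hgd : DifferentiableOn ℂ g {w | 5 < w.im})
    (hg : ∀ w : ℂ, 5 < w.im → 4 ≤ (g w).im ∧ cauchyTransform μ (g w) = w⁻¹ ∧ ‖g w - w‖ ≤ 1) :
    IsVoiculescuTransform ρ α 5 fun w => w⁻¹ + (g w - w) := by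
  have hinv : ∀ w : ℂ, 5 < w.im → ‖w⁻¹‖ ≤ 1 := by
    intro w hw
    rw [norm_inv]
    refine inv_le_one_of_one_le₀ ?_
    linarith [(le_abs_self _).trans (Complex.abs_im_le_norm w)]
  have hne : ∀ w : ℂ, 5 < w.im → w ≠ 0 := by
    rintro w hw rfl
    simp at hw
    linarith
  have e : ∀ w : ℂ, 5 < w.im → w + (w⁻¹ + (g w - w)) = g w + cauchyTransform μ (g w) := by
    intro w hw
    rw [(hg w hw).2.1]
    ring
  have him : ∀ w : ℂ, 5 < w.im → 0 < (w + (w⁻¹ + (g w - w))).im := by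
    intro w hw
    rw [e w hw, (hg w hw).2.1, add_im]
    have h1 := (abs_le.1 ((Complex.abs_im_le_norm _).trans (hinv w hw))).1
    linarith [(hg w hw).1]
  refine .of_norm_le (C := 2) ?_ (fun w hw => ?_) him fun w hw => ?_
  · exact (differentiableOn_inv.mono fun w hw => hne w hw).add (hgd.sub differentiableOn_id)
  · exact (norm_add_le _ _).trans (by linarith [hinv w hw, (hg w hw).2.2])
  · have h4 := (hg w hw).1
    have h0 : 0 < (g w).im := by linarith
    -- `Im (g w) ≥ 4` puts `g w` inside the domain, so `ω` really undoes `w ↦ w + G_μ(w)` there.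
    have hmem : g w ∈ subordinationDomain μ := by
      refine ⟨h0, (sqResolvent_le μ h0).trans ?_⟩
      exact pow_le_one₀ (by positivity) (inv_le_one_of_one_le₀ (by linarith))
    rw [hρ _ (him w hw), e w hw, subordination_add_cauchyTransform hmem, add_sub_cancel_left,
      (hg w hw).2.1]

/-! ### The Cauchy transform of the semicircle law -/

theorem one_add_sq_sub_two_mul_cos_eq (q : ℂ) (θ : ℝ) :
    1 + q ^ 2 - 2 * q * Real.cos θ = (1 - q * circleMap 0 1 θ) * (1 - q * circleMap 0 1 (-θ)) := by
  have h1 : circleMap 0 1 θ + circleMap 0 1 (-θ) = 2 * Real.cos θ := by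
    simp only [circleMap, zero_add, ofReal_one, one_mul, exp_mul_I, ofReal_neg, cos_neg, sin_neg,
      ofReal_cos]
    ring
  have h2 : circleMap 0 1 θ * circleMap 0 1 (-θ) = 1 := by
    simp [circleMap, ← Complex.exp_add]
  linear_combination q * h1 - q ^ 2 * h2

theorem one_sub_mul_circleMap_ne_zero {q : ℂ} (hq : ‖q‖ < 1) (θ : ℝ) :
    1 - q * circleMap 0 1 θ ≠ 0 := by
  intro h
  have h1 : ‖q * circleMap 0 1 θ‖ = 1 := by
    rw [← sub_eq_zero.1 h, norm_one]
  rw [norm_mul, norm_circleMap_zero, abs_one, mul_one] at h1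
  linarith

theorem one_add_sq_sub_two_mul_cos_ne_zero {q : ℂ} (hq : ‖q‖ < 1) (θ : ℝ) :
    1 + q ^ 2 - 2 * q * Real.cos θ ≠ 0 := by
  rw [one_add_sq_sub_two_mul_cos_eq]
  exact mul_ne_zero (one_sub_mul_circleMap_ne_zero hq θ) (one_sub_mul_circleMap_ne_zero hq _)

theorem one_sub_sq_ne_zero {q : ℂ} (hq : ‖q‖ < 1) : 1 - q ^ 2 ≠ 0 := by
  intro h
  have h1 : ‖q‖ ^ 2 = 1 := by rw [← norm_pow, ← sub_eq_zero.1 h, norm_one]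
  nlinarith [norm_nonneg q]

/-- On the unit circle this is Cauchy's formula at `q` for `ζ ↦ (1 - q ζ)⁻¹`. -/
theorem integral_inv_one_add_sq_sub_two_mul_cos_two_pi {q : ℂ} (hq : ‖q‖ < 1) :
    ∫ θ in (0 : ℝ)..2 * Real.pi, (1 + q ^ 2 - 2 * q * Real.cos θ)⁻¹ =
      2 * Real.pi / (1 - q ^ 2) := by
  have hd : DifferentiableOn ℂ (fun ζ => (1 - q * ζ)⁻¹) (Metric.closedBall 0 1) := by
    refine DifferentiableOn.inv (by fun_prop) fun ζ hζ h => ?_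
    have h1 : ‖q * ζ‖ = 1 := by rw [← sub_eq_zero.1 h, norm_one]
    rw [norm_mul] at h1
    nlinarith [mem_closedBall_zero_iff.1 hζ, norm_nonneg q, norm_nonneg ζ]
  have h := hd.circleIntegral_sub_inv_smul (w := q) (by simpa using hq)
  rw [circleIntegral] at h
  have e : ∀ θ : ℝ, deriv (circleMap 0 1) θ • ((circleMap 0 1 θ - q)⁻¹ •
      (1 - q * circleMap 0 1 θ)⁻¹) = I * (1 + q ^ 2 - 2 * q * Real.cos θ)⁻¹ := by
    intro θ
    have h2 : circleMap 0 1 θ * circleMap 0 1 (-θ) = 1 := by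
      simp [circleMap, ← Complex.exp_add]
    have h3 : circleMap 0 1 θ - q = circleMap 0 1 θ * (1 - q * circleMap 0 1 (-θ)) := by
      linear_combination q * h2
    have h4 : circleMap 0 1 θ ≠ 0 := left_ne_zero_of_mul_eq_one h2
    have h5 := one_sub_mul_circleMap_ne_zero hq θ
    have h6 := one_sub_mul_circleMap_ne_zero hq (-θ)
    rw [deriv_circleMap, h3, one_add_sq_sub_two_mul_cos_eq, smul_eq_mul, smul_eq_mul]
    field_simp
  simp only [e] at h
  rw [intervalIntegral.integral_const_mul, smul_eq_mul] at h
  have h7 := one_sub_sq_ne_zero hq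
  apply mul_left_cancel₀ I_ne_zero
  rw [h, ← sq]
  field_simp

theorem integral_inv_one_add_sq_sub_two_mul_cos {q : ℂ} (hq : ‖q‖ < 1) :
    ∫ θ in (0 : ℝ)..Real.pi, (1 + q ^ 2 - 2 * q * Real.cos θ)⁻¹ = Real.pi / (1 - q ^ 2) := by
  have hc : Continuous fun θ : ℝ => (1 + q ^ 2 - 2 * q * Real.cos θ)⁻¹ :=
    Continuous.inv₀ (by fun_prop) (one_add_sq_sub_two_mul_cos_ne_zero hq)
  have h1 := integral_inv_one_add_sq_sub_two_mul_cos_two_pi hq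
  rw [← intervalIntegral.integral_add_adjacent_intervals
    (hc.intervalIntegrable 0 Real.pi) (hc.intervalIntegrable _ _)] at h1
  have h2 := intervalIntegral.integral_comp_sub_left (a := 0) (b := Real.pi)
    (fun θ : ℝ => (1 + q ^ 2 - 2 * q * Real.cos θ)⁻¹) (2 * Real.pi)
  simp only [Real.cos_two_pi_sub, sub_zero] at h2
  rw [show 2 * Real.pi - Real.pi = Real.pi by ring] at h2
  rw [← h2, ← two_mul] at h1
  apply mul_left_cancel₀ (two_ne_zero (α := ℂ))
  rw [h1]
  ring

theorem cauchyTransform_semicircleLaw {z : ℂ} (hz : 0 < z.im) :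
    cauchyTransform semicircleLaw z =
      ∫ θ in (0 : ℝ)..Real.pi, (2 * Real.sin θ ^ 2 / Real.pi : ℂ) * (z - 2 * Real.cos θ)⁻¹ := by
  set g : ℝ → ℂ := fun x => ((√(4 - x ^ 2) / (2 * Real.pi) : ℝ) : ℂ) * (z - x)⁻¹ with hg
  have hgc : Continuous g :=
    (by fun_prop : Continuous fun x : ℝ => ((√(4 - x ^ 2) / (2 * Real.pi) : ℝ) : ℂ)).mul
      (Continuous.inv₀ (by fun_prop) (sub_ofReal_ne_zero hz))
  have h1 : cauchyTransform semicircleLaw z = ∫ x, g x := by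
    change ∫ x : ℝ, (z - (x : ℂ))⁻¹ ∂(volume.withDensity fun x =>
      ENNReal.ofReal (√(4 - x ^ 2) / (2 * Real.pi))) = _
    rw [integral_withDensity_eq_integral_toReal_smul (by fun_prop) (by simp)]
    congr 1 with x
    rw [ENNReal.toReal_ofReal (by positivity), real_smul]
  have h2 : ∫ x, g x = ∫ x in (-2 : ℝ)..2, g x := by
    rw [intervalIntegral.integral_of_le (by norm_num), ← integral_Icc_eq_integral_Ioc]
    symm
    apply setIntegral_eq_integral_of_forall_compl_eq_zero
    intro x hx
    have : √(4 - x ^ 2) = 0 := by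
      apply Real.sqrt_eq_zero_of_nonpos
      by_contra h
      exact hx ⟨by nlinarith, by nlinarith⟩
    simp [hg, this]
  have h3 := intervalIntegral.integral_deriv_smul_comp (a := 0) (b := Real.pi)
    (f := fun θ => 2 * Real.cos θ) (f' := fun θ => 2 * -Real.sin θ) (g := g)
    (fun θ _ => (Real.hasDerivAt_cos θ).const_mul 2) (by fun_prop) hgc
  simp only [Real.cos_zero, Real.cos_pi] at h3
  norm_num at h3
  rw [h1, h2, intervalIntegral.integral_symm, ← h3, neg_neg]
  refine intervalIntegral.integral_congr fun θ hθ => ?_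
  rw [Set.uIcc_of_le Real.pi_pos.le] at hθ
  have hs := Real.sin_nonneg_of_nonneg_of_le_pi hθ.1 hθ.2
  have h4 : √(4 - (2 * Real.cos θ) ^ 2) = 2 * Real.sin θ := by
    rw [show 4 - (2 * Real.cos θ) ^ 2 = (2 * Real.sin θ) ^ 2 by
      nlinarith [Real.sin_sq_add_cos_sq θ]]
    exact Real.sqrt_sq (by positivity)
  have hpi : (Real.pi : ℂ) ≠ 0 := ofReal_ne_zero.2 Real.pi_ne_zero
  simp only [hg, h4]
  push_cast
  field_simp

/-- After `x = 2 cos θ`, division of the numerator by `1 + q² - 2q cos θ` leaves a constant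
remainder, whose integral is known, and a quotient whose cosine part integrates to zero. At `q =
w⁻¹` this yields the Voiculescu transform `w⁻¹`. -/
theorem cauchyTransform_semicircleLaw_add_inv {q : ℂ} (hq : ‖q‖ < 1) (hq0 : q ≠ 0)
    (hz : 0 < (q⁻¹ + q).im) : cauchyTransform semicircleLaw (q⁻¹ + q) = q := by
  have hpi : (Real.pi : ℂ) ≠ 0 := ofReal_ne_zero.2 Real.pi_ne_zero
  have hc : Continuous fun θ : ℝ => (1 + q ^ 2 - 2 * q * Real.cos θ)⁻¹ :=
    Continuous.inv₀ (by fun_prop) (one_add_sq_sub_two_mul_cos_ne_zero hq)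
  have e : ∀ θ : ℝ, (2 * Real.sin θ ^ 2 / Real.pi : ℂ) * (q⁻¹ + q - 2 * Real.cos θ)⁻¹ =
      (2 * Real.pi * q)⁻¹ * (-(1 - q ^ 2) ^ 2 * (1 + q ^ 2 - 2 * q * Real.cos θ)⁻¹ +
        ((1 + q ^ 2) + 2 * q * (Real.cos θ : ℝ))) := by
    intro θ
    have h1 := one_add_sq_sub_two_mul_cos_ne_zero hq θ
    have h2 : q⁻¹ + q - 2 * Real.cos θ = (1 + q ^ 2 - 2 * q * Real.cos θ) * q⁻¹ := by
      field_simp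
    have h3 : ((Real.sin θ : ℝ) : ℂ) ^ 2 = 1 - ((Real.cos θ : ℝ) : ℂ) ^ 2 := by
      rw [← ofReal_pow, Real.sin_sq]
      push_cast
      ring
    rw [h2, h3]
    generalize ((Real.cos θ : ℝ) : ℂ) = c at *
    have key : 4 * q ^ 2 * (1 - c ^ 2) =
        -(1 - q ^ 2) ^ 2 + (1 + q ^ 2 + 2 * q * c) * (1 + q ^ 2 - 2 * q * c) := by ring
    generalize 1 + q ^ 2 - 2 * q * c = D at *
    field_simp
    linear_combination key
  have hcos : ∫ θ in (0 : ℝ)..Real.pi, ((Real.cos θ : ℝ) : ℂ) = 0 := by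
    rw [intervalIntegral.integral_ofReal]
    simp
  have hc2 : Continuous fun θ : ℝ => (1 + q ^ 2) + 2 * q * ((Real.cos θ : ℝ) : ℂ) := by fun_prop
  have hc3 : Continuous fun θ : ℝ => 2 * q * ((Real.cos θ : ℝ) : ℂ) := by fun_prop
  rw [cauchyTransform_semicircleLaw hz]
  simp only [e]
  rw [intervalIntegral.integral_const_mul,
    intervalIntegral.integral_add ((hc.intervalIntegrable _ _).const_mul _)
      (hc2.intervalIntegrable _ _),
    intervalIntegral.integral_add intervalIntegrable_const (hc3.intervalIntegrable _ _),
    intervalIntegral.integral_const_mul, intervalIntegral.integral_const_mul, hcos,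
    integral_inv_one_add_sq_sub_two_mul_cos hq, intervalIntegral.integral_const]
  have h7 := one_sub_sq_ne_zero hq
  rw [sub_zero, real_smul]
  field_simp
  ring

theorem isVoiculescuTransform_semicircleLaw (α : ℝ) :
    IsVoiculescuTransform semicircleLaw α 5 fun w => w⁻¹ := by
  have hn : ∀ w : ℂ, 5 < w.im → 5 < ‖w‖ := fun w hw =>
    hw.trans_le ((le_abs_self _).trans (Complex.abs_im_le_norm w))
  have hne : ∀ w : ℂ, 5 < w.im → w ≠ 0 := by
    rintro w hw rfl
    simp at hw
    linarith
  have hlt : ∀ w : ℂ, 5 < w.im → ‖w⁻¹‖ < 1 := by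
    intro w hw
    rw [norm_inv]
    exact inv_lt_one_of_one_lt₀ (by linarith [hn w hw])
  have him : ∀ w : ℂ, 5 < w.im → 0 < (w + w⁻¹).im := by
    intro w hw
    rw [add_im]
    have := (abs_le.1 ((Complex.abs_im_le_norm _).trans (hlt w hw).le)).1
    linarith
  refine .of_norm_le (C := 1) (differentiableOn_inv.mono fun w hw => hne w hw)
    (fun w hw => (hlt w hw).le) him fun w hw => ?_
  have := cauchyTransform_semicircleLaw_add_inv (q := w⁻¹) (hlt w hw) (inv_ne_zero (hne w hw))
    (by rw [inv_inv]; exact him w hw)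
  rwa [inv_inv] at this

/-! ### Uniqueness: Voiculescu transforms determine the measure -/

section

variable {α β : ℝ} {φ φ' : ℂ → ℂ} {μ : ProbabilityMeasure ℝ}

theorem tendsto_ofReal_mul_I (hα : 0 < α) :
    Tendsto (fun y : ℝ => (y * I : ℂ)) atTop
      (Bornology.cobounded ℂ ⊓ 𝓟 (truncatedCone α β)) := by
  refine tendsto_inf.2 ⟨?_, tendsto_principal.2 ?_⟩
  · rw [← tendsto_norm_atTop_iff_cobounded]
    simpa using tendsto_abs_atTop_atTop
  · filter_upwards [eventually_gt_atTop 0, eventually_gt_atTop β] with y h0 hβ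
    exact ⟨by simpa using mul_pos hα h0, by simpa using hβ⟩

theorem eventually_mul_I_mem_truncatedCone (hα : 0 < α) :
    ∀ᶠ y : ℝ in atTop, (y * I : ℂ) ∈ truncatedCone α β :=
  (tendsto_ofReal_mul_I hα).eventually (mem_inf_of_right (mem_principal_self _))

theorem IsVoiculescuTransform.tendsto_div (hφ : IsVoiculescuTransform μ α β φ) (hα : 0 < α) :
    Tendsto (fun y : ℝ => φ (y * I) / (y * I)) atTop (𝓝 0) :=
  (hφ.isLittleO.comp_tendsto (tendsto_ofReal_mul_I hα)).tendsto_div_nhds_zero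

theorem tendsto_mul_I_mul_inv_add_sub {ψ : ℂ → ℂ}
    (h : Tendsto (fun y : ℝ => ψ (y * I) / (y * I)) atTop (𝓝 0)) (s : ℝ) :
    Tendsto (fun y : ℝ => y * I * (y * I + ψ (y * I) - s)⁻¹) atTop (𝓝 1) := by
  have h6 : Tendsto (fun y : ℝ => ((y⁻¹ : ℝ) : ℂ)) atTop (𝓝 0) := by
    rw [← ofReal_zero]
    exact (continuous_ofReal.tendsto 0).comp tendsto_inv_atTop_zero
  have h7 : Tendsto (fun y : ℝ => 1 + ψ (y * I) / (y * I) - s * I⁻¹ * ((y⁻¹ : ℝ) : ℂ)) atTop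
      (𝓝 1) := by
    simpa using (h.const_add 1).sub (h6.const_mul (s * I⁻¹ : ℂ))
  have h8 := h7.inv₀ one_ne_zero
  rw [inv_one] at h8
  refine h8.congr' ?_
  filter_upwards [eventually_gt_atTop 0] with y hy
  have hy' : (y : ℂ) ≠ 0 := ofReal_ne_zero.2 hy.ne'
  have hI := I_ne_zero
  have h9 : 1 + ψ (y * I) / (y * I) - s * I⁻¹ * ((y⁻¹ : ℝ) : ℂ) =
      (y * I + ψ (y * I) - s) * (y * I)⁻¹ := by
    push_cast
    field_simp
  rw [h9, mul_inv, inv_inv, mul_comm]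

theorem eventually_norm_mul_I_mul_inv_le {ψ : ℂ → ℂ}
    (h : Tendsto (fun y : ℝ => ψ (y * I) / (y * I)) atTop (𝓝 0)) :
    ∀ᶠ y : ℝ in atTop, ∀ s : ℝ, ‖y * I * (y * I + ψ (y * I) - s)⁻¹‖ ≤ 2 := by
  have h1 : ∀ᶠ y : ℝ in atTop, ‖ψ (y * I) / (y * I)‖ < 1 / 2 :=
    h.norm.eventually_lt_const (by simp)
  filter_upwards [h1, eventually_gt_atTop 0] with y h2 hy s
  have h3 : ‖(y * I : ℂ)‖ = y := by simp [abs_of_pos hy]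
  rw [norm_div, h3, div_lt_iff₀ hy] at h2
  have h4 := (abs_le.1 (Complex.abs_im_le_norm (ψ (y * I)))).1
  have h5 : y / 2 ≤ (y * I + ψ (y * I)).im := by
    simp only [add_im, mul_im, ofReal_re, I_im, mul_one, ofReal_im, I_re, mul_zero, add_zero]
    linarith
  have h6 : (0 : ℝ) < (y * I + ψ (y * I)).im := by linarith
  rw [norm_mul, h3]
  calc y * ‖(y * I + ψ (y * I) - s)⁻¹‖ ≤ y * (y / 2)⁻¹ :=
        mul_le_mul_of_nonneg_left ((norm_inv_sub_ofReal_le h6 s).trans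
          (inv_anti₀ (by linarith) h5)) hy.le
    _ = 2 := by field_simp

theorem tendsto_integral_inv_mul_inv (μ : ProbabilityMeasure ℝ) {ψ ψ' : ℂ → ℂ}
    (h : Tendsto (fun y : ℝ => ψ (y * I) / (y * I)) atTop (𝓝 0))
    (h' : Tendsto (fun y : ℝ => ψ' (y * I) / (y * I)) atTop (𝓝 0)) :
    Tendsto (fun y : ℝ => ∫ s : ℝ, (y * I * (y * I + ψ (y * I) - s)⁻¹) *
      (y * I * (y * I + ψ' (y * I) - s)⁻¹) ∂(μ : Measure ℝ)) atTop (𝓝 1) := by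
  have h1 : ∫ _ : ℝ, (1 : ℂ) ∂(μ : Measure ℝ) = 1 := by simp
  rw [← h1]
  refine tendsto_integral_filter_of_dominated_convergence (fun _ => 2 * 2)
    (.of_forall fun y => by fun_prop) ?_ (integrable_const _) (.of_forall fun s => ?_)
  · filter_upwards [eventually_norm_mul_I_mul_inv_le h, eventually_norm_mul_I_mul_inv_le h']
      with y h2 h3
    refine .of_forall fun s => ?_
    rw [norm_mul]
    exact mul_le_mul (h2 s) (h3 s) (norm_nonneg _) (by norm_num)
  · simpa using (tendsto_mul_I_mul_inv_add_sub h s).mul (tendsto_mul_I_mul_inv_add_sub h' s)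

theorem IsVoiculescuTransform.cauchyTransform_eq (hφ : IsVoiculescuTransform μ α β φ) {w : ℂ}
    (hw : w ∈ truncatedCone α β) : cauchyTransform μ (w + φ w) = w⁻¹ := by
  rw [← hφ.right_inverse w hw, reciprocalCauchyTransform, inv_inv, ← reciprocalCauchyTransform,
    hφ.right_inverse w hw]

/-- If the transforms differed at `i y`, two points would share a Cauchy transform value, forcing `∫
(a - s)⁻¹ (b - s)⁻¹ = 0`. Multiplied by `(i y)²`, this integral tends to `1`. -/
theorem IsVoiculescuTransform.eventually_eq {α' β' : ℝ} (hφ : IsVoiculescuTransform μ α β φ)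
    (hφ' : IsVoiculescuTransform μ α' β' φ') (hα : 0 < α) (hα' : 0 < α') :
    ∀ᶠ y : ℝ in atTop, φ (y * I) = φ' (y * I) := by
  have h1 := tendsto_integral_inv_mul_inv μ (hφ.tendsto_div hα) (hφ'.tendsto_div hα')
  filter_upwards [h1.eventually_ne one_ne_zero, eventually_mul_I_mem_truncatedCone hα,
    eventually_mul_I_mem_truncatedCone hα'] with y h2 h3 h4
  by_contra hne
  apply h2
  have h5 := cauchyTransform_sub_cauchyTransform μ (hφ.im_pos _ h3) (hφ'.im_pos _ h4)
  rw [hφ.cauchyTransform_eq h3, hφ'.cauchyTransform_eq h4, sub_self, zero_eq_mul] at h5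
  have h6 := h5.resolve_left fun h => hne (by linear_combination -h)
  have h7 : ∀ s : ℝ, (y * I * (y * I + φ (y * I) - s)⁻¹) * (y * I * (y * I + φ' (y * I) - s)⁻¹) =
      (y * I) ^ 2 * ((y * I + φ (y * I) - s)⁻¹ * (y * I + φ' (y * I) - s)⁻¹) := by
    intro s
    ring
  simp only [h7]
  rw [integral_const_mul, h6, mul_zero]

/-- Poisson smoothing of a measure, written through its Cauchy transform. -/
theorem integral_mul_im_cauchyTransform (μ : ProbabilityMeasure ℝ)
    (f : BoundedContinuousFunction ℝ ℝ) {y : ℝ} (hy : 0 < y) :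
    ∫ x : ℝ, f x * (-(cauchyTransform μ (x + y * I)).im / Real.pi) =
      ∫ s, (∫ t : ℝ, f (s + y * t) * (Real.pi⁻¹ * (1 + t ^ 2)⁻¹)) ∂(μ : Measure ℝ) := by
  set P : ℝ → ℝ := cauchyPDFReal 0 y.toNNReal with hP
  have hP' : ∀ u, P u = Real.pi⁻¹ * y * (u ^ 2 + y ^ 2)⁻¹ := by
    intro u
    rw [hP, cauchyPDFReal_def, Real.coe_toNNReal _ hy.le, sub_zero]
  have hPi : Integrable P := integrable_cauchyPDFReal 0
  have hPc : Continuous P := by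
    rw [funext hP']
    exact continuous_const.mul (Continuous.inv₀ (by fun_prop) fun u => by positivity)
  have hP0 : ∀ u, 0 ≤ P u := fun u => by rw [hP']; positivity
  have h1 : ∀ x : ℝ, f x * (-(cauchyTransform μ (x + y * I)).im / Real.pi) =
      ∫ s, f x * P (x - s) ∂(μ : Measure ℝ) := by
    intro x
    rw [integral_const_mul, im_cauchyTransform μ (by simpa using hy), sqResolvent, neg_neg,
      ← integral_const_mul, ← integral_div]
    congr 2 with s
    rw [hP', normSq_apply]
    simp only [sub_re, add_re, ofReal_re, mul_re, I_re, mul_zero, ofReal_im, I_im, mul_one,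
      sub_self, add_zero, sub_im, add_im, mul_im, zero_add, sub_zero]
    rw [sq, sq]
    ring
  have hint : Integrable (Function.uncurry fun (x s : ℝ) => f x * P (x - s))
      (volume.prod (μ : Measure ℝ)) := by
    have hc : Continuous (Function.uncurry fun (x s : ℝ) => f x * P (x - s)) := by
      have := f.continuous
      fun_prop
    rw [integrable_prod_iff' hc.aestronglyMeasurable]
    refine ⟨.of_forall fun s => ?_, ?_⟩
    · exact (hPi.comp_sub_right s).bdd_mul (c := ‖f‖) f.continuous.aestronglyMeasurable
        (.of_forall f.norm_coe_le_norm)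
    · refine Integrable.of_bound (C := ‖f‖ * ∫ u, P u)
        (hc.norm.comp continuous_swap).aestronglyMeasurable.integral_prod_right' (.of_forall fun s => ?_)
      rw [Real.norm_of_nonneg (integral_nonneg fun x => norm_nonneg _),
        ← integral_sub_right_eq_self P s, ← integral_const_mul]
      refine integral_mono_of_nonneg (.of_forall fun x => norm_nonneg _)
        ((hPi.comp_sub_right s).const_mul _) (.of_forall fun x => ?_)
      simp only [Function.uncurry, norm_mul, Real.norm_of_nonneg (hP0 _)]
      exact mul_le_mul_of_nonneg_right (f.norm_coe_le_norm x) (hP0 _)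
  simp only [h1]
  rw [integral_integral_swap hint]
  congr 1 with s
  have h2 : ∫ x, f x * P (x - s) = ∫ u, f (s + u) * P u := by
    rw [← integral_sub_right_eq_self (fun u => f (s + u) * P u) s]
    simp
  have h3 := Measure.integral_comp_mul_left (fun u => f (s + u) * P u) y
  have h4 : ∀ t : ℝ, f (s + y * t) * (Real.pi⁻¹ * (1 + t ^ 2)⁻¹) =
      y * (f (s + y * t) * P (y * t)) := by
    intro t
    rw [hP']
    have := Real.pi_pos.ne'
    have h5 : (y * t) ^ 2 + y ^ 2 = y ^ 2 * (1 + t ^ 2) := by ring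
    have h6 : 1 + t ^ 2 ≠ 0 := by positivity
    rw [h5]
    field_simp
  simp only [h4]
  rw [h2, integral_const_mul, h3, abs_of_pos (inv_pos.2 hy), smul_eq_mul,
    mul_inv_cancel_left₀ hy.ne']

/-- Stieltjes inversion in weak form: the Poisson kernel is an approximate identity, and dominated
convergence is applied first in `t`, then in `s`. -/
theorem tendsto_integral_mul_im_cauchyTransform (μ : ProbabilityMeasure ℝ)
    (f : BoundedContinuousFunction ℝ ℝ) :
    Tendsto (fun y : ℝ => ∫ x : ℝ, f x * (-(cauchyTransform μ (x + y * I)).im / Real.pi))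
      (𝓝[>] 0) (𝓝 (∫ s, f s ∂(μ : Measure ℝ))) := by
  have hk : Integrable fun t : ℝ => Real.pi⁻¹ * (1 + t ^ 2)⁻¹ :=
    integrable_inv_one_add_sq.const_mul _
  have hkv : ∫ t : ℝ, Real.pi⁻¹ * (1 + t ^ 2)⁻¹ = 1 := by
    rw [integral_const_mul, integral_univ_inv_one_add_sq, inv_mul_cancel₀ Real.pi_ne_zero]
  have hpi := Real.pi_pos
  have hbd : ∀ (y s t : ℝ), ‖f (s + y * t) * (Real.pi⁻¹ * (1 + t ^ 2)⁻¹)‖ ≤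
      ‖f‖ * (Real.pi⁻¹ * (1 + t ^ 2)⁻¹) := by
    intro y s t
    rw [norm_mul, Real.norm_of_nonneg (show 0 ≤ Real.pi⁻¹ * (1 + t ^ 2)⁻¹ by positivity)]
    exact mul_le_mul_of_nonneg_right (f.norm_coe_le_norm _) (by positivity)
  have hcont : Continuous fun t : ℝ => (1 + t ^ 2)⁻¹ :=
    Continuous.inv₀ (by fun_prop) fun t => by positivity
  have hf := f.continuous
  have hconv : ∀ s : ℝ, Tendsto (fun y : ℝ => ∫ t : ℝ, f (s + y * t) *
      (Real.pi⁻¹ * (1 + t ^ 2)⁻¹)) (𝓝[>] 0) (𝓝 (f s)) := by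
    intro s
    have h1 : ∫ t : ℝ, f s * (Real.pi⁻¹ * (1 + t ^ 2)⁻¹) = f s := by
      rw [integral_const_mul, hkv, mul_one]
    have h2 : Tendsto (fun y : ℝ => ∫ t : ℝ, f (s + y * t) * (Real.pi⁻¹ * (1 + t ^ 2)⁻¹)) (𝓝[>] 0)
        (𝓝 (∫ t : ℝ, f s * (Real.pi⁻¹ * (1 + t ^ 2)⁻¹))) := by
      refine tendsto_integral_filter_of_dominated_convergence
        (fun t => ‖f‖ * (Real.pi⁻¹ * (1 + t ^ 2)⁻¹))
        (.of_forall fun y => Continuous.aestronglyMeasurable (by fun_prop))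
        (.of_forall fun y => .of_forall (hbd y s)) (hk.const_mul _) (.of_forall fun t => ?_)
      have h3 : Continuous fun y : ℝ => f (s + y * t) * (Real.pi⁻¹ * (1 + t ^ 2)⁻¹) := by fun_prop
      simpa using (h3.tendsto 0).mono_left nhdsWithin_le_nhds
    rwa [h1] at h2
  have hmain : Tendsto (fun y : ℝ => ∫ s, (∫ t : ℝ, f (s + y * t) *
      (Real.pi⁻¹ * (1 + t ^ 2)⁻¹)) ∂(μ : Measure ℝ)) (𝓝[>] 0) (𝓝 (∫ s, f s ∂(μ : Measure ℝ))) := by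
    refine tendsto_integral_filter_of_dominated_convergence (fun _ => ‖f‖)
      (.of_forall fun y => ?_) (.of_forall fun y => .of_forall fun s => ?_) (integrable_const _)
      (.of_forall hconv)
    · have h4 : Continuous (Function.uncurry fun (s t : ℝ) =>
          f (s + y * t) * (Real.pi⁻¹ * (1 + t ^ 2)⁻¹)) :=
        (hf.comp (by fun_prop)).mul (continuous_const.mul (hcont.comp continuous_snd))
      exact h4.aestronglyMeasurable.integral_prod_right'
    · have h5 := norm_integral_le_of_norm_le (hk.const_mul ‖f‖) (.of_forall (hbd y s))
      rwa [integral_const_mul, hkv, mul_one] at h5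
  refine hmain.congr' ?_
  filter_upwards [self_mem_nhdsWithin] with y hy
  exact (integral_mul_im_cauchyTransform μ f hy).symm

/-- A probability measure is determined by its Cauchy transform. -/
theorem eq_of_cauchyTransform_eq {μ ν : ProbabilityMeasure ℝ}
    (h : ∀ z : ℂ, 0 < z.im → cauchyTransform μ z = cauchyTransform ν z) : μ = ν := by
  apply Subtype.ext
  refine ext_of_forall_integral_eq_of_IsFiniteMeasure (μ := (μ : Measure ℝ))
    (ν := (ν : Measure ℝ)) fun f => ?_
  refine tendsto_nhds_unique (tendsto_integral_mul_im_cauchyTransform μ f)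
    ((tendsto_integral_mul_im_cauchyTransform ν f).congr' ?_)
  filter_upwards [self_mem_nhdsWithin] with y hy
  congr 1 with x
  rw [h _ (by simpa using hy)]

/-- Both Cauchy transforms equal `(i y)⁻¹` along the curve `i y + φ(i y)`. These distinct values
make the curve injective, so its points accumulate at one of them and the identity theorem applies.
-/
theorem eq_of_isVoiculescuTransform {ρ ρ' : ProbabilityMeasure ℝ} {α' β' : ℝ}
    (hρ : IsVoiculescuTransform ρ α β φ) (hρ' : IsVoiculescuTransform ρ' α' β' φ')
    (hα : 0 < α) (hα' : 0 < α') (h : ∀ᶠ y : ℝ in atTop, φ (y * I) = φ' (y * I)) : ρ = ρ' := by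
  obtain ⟨Y, hY⟩ := eventually_atTop.1 (h.and ((eventually_mul_I_mem_truncatedCone
    (β := β) hα).and (eventually_mul_I_mem_truncatedCone (β := β') hα')))
  set b : ℝ → ℂ := fun y => y * I + φ (y * I) with hb
  have hnear : ∀ᶠ y in 𝓝 (Y + 1), Y ≤ y := eventually_ge_nhds (by linarith)
  have hG : ∀ y, Y ≤ y → cauchyTransform ρ (b y) = (y * I)⁻¹ := fun y hy =>
    hρ.cauchyTransform_eq (hY y hy).2.1
  have hG' : ∀ y, Y ≤ y → cauchyTransform ρ' (b y) = (y * I)⁻¹ := by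
    intro y hy
    have := hρ'.cauchyTransform_eq (hY y hy).2.2
    rwa [← (hY y hy).1] at this
  have hbinj : ∀ y, Y ≤ y → y ≠ Y + 1 → b y ≠ b (Y + 1) := by
    intro y hy hne heq
    have h1 := hG y hy
    rw [heq, hG _ (by linarith), inv_inj] at h1
    exact hne (ofReal_injective (mul_right_cancel₀ I_ne_zero h1)).symm
  have hopen : IsOpen (truncatedCone α β) := by
    have h1 : IsOpen {w : ℂ | |w.re| < α * w.im} :=
      isOpen_lt (continuous_abs.comp continuous_re) (continuous_const.mul continuous_im)
    exact h1.inter (isOpen_setOf_lt_im β)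
  have hbc : ContinuousAt b (Y + 1) := by
    have h1 : ContinuousAt φ ((Y + 1 : ℝ) * I) :=
      (hρ.analytic.differentiableAt (hopen.mem_nhds (hY _ (by linarith)).2.1)).continuousAt
    have h2 : Continuous fun y : ℝ => (y * I : ℂ) := by fun_prop
    exact h2.continuousAt.add (ContinuousAt.comp (f := fun y : ℝ => (y * I : ℂ)) h1 h2.continuousAt)
  have htend : Tendsto b (𝓝[≠] (Y + 1)) (𝓝[≠] b (Y + 1)) := by
    refine tendsto_nhdsWithin_iff.2 ⟨hbc.tendsto.mono_left nhdsWithin_le_nhds, ?_⟩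
    filter_upwards [nhdsWithin_le_nhds hnear, self_mem_nhdsWithin] with y hy hne
    exact hbinj y hy hne
  have hfreq : ∃ᶠ z in 𝓝[≠] b (Y + 1), cauchyTransform ρ z = cauchyTransform ρ' z := by
    refine htend.frequently (Eventually.frequently ?_)
    filter_upwards [nhdsWithin_le_nhds hnear] with y hy
    rw [hG y hy, hG' y hy]
  have han : ∀ ν : ProbabilityMeasure ℝ, AnalyticOnNhd ℂ (cauchyTransform ν) {z | 0 < z.im} :=
    fun ν => (differentiableOn_cauchyTransform ν).analyticOnNhd isOpen_upperHalfPlane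
  exact eq_of_cauchyTransform_eq ((han ρ).eqOn_of_preconnected_of_frequently_eq (han ρ')
    (convex_halfSpace_im_gt 0).isPreconnected (hρ.im_pos _ (hY _ (by linarith)).2.1) hfreq)

theorem IsFreeAdditiveConvolution.unique {μ ν ρ ρ' : ProbabilityMeasure ℝ}
    (h : IsFreeAdditiveConvolution μ ν ρ) (h' : IsFreeAdditiveConvolution μ ν ρ') : ρ = ρ' := by
  obtain ⟨α, hα, β, -, φ₁, φ₂, h1, h2, h3⟩ := h
  obtain ⟨α', hα', β', -, φ₁', φ₂', h1', h2', h3'⟩ := h'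
  refine eq_of_isVoiculescuTransform h3 h3' hα hα' ?_
  filter_upwards [h1.eventually_eq h1' hα hα', h2.eventually_eq h2' hα hα'] with y e1 e2
  rw [e1, e2]

end

end FreeProb

theorem lemma3p10 :
    ∃ ρ : ProbabilityMeasure ℝ,
      FreeProb.IsFreeAdditiveConvolution FreeProb.semicircleLaw FreeProb.gaussianLaw ρ ∧
      (∀ ρ' : ProbabilityMeasure ℝ,
        FreeProb.IsFreeAdditiveConvolution FreeProb.semicircleLaw FreeProb.gaussianLaw ρ' →
          ρ' = ρ) ∧
      ∃ p : ℝ → ℝ, Continuous p ∧ (∀ x, 0 ≤ p x) ∧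
        (ρ : Measure ℝ) = volume.withDensity (fun x => ENNReal.ofReal (p x)) ∧
        ∃ C > 0, ∀ x : ℝ, p x ≤ C * Real.exp (-x ^ 2 / 2) := by
  have hb := FreeProb.imBoundedBelow_gaussianLaw
  have hγ := FreeProb.isStandardized_gaussianLaw
  obtain ⟨ρ, hdens, hρ⟩ := FreeProb.exists_probabilityMeasure_cauchyTransform_eq hγ hb
    FreeProb.integrable_subordinationDensity_gaussianLaw
  obtain ⟨g, hgd, hg⟩ := hγ.exists_inverse
  have hconv : FreeProb.IsFreeAdditiveConvolution FreeProb.semicircleLaw FreeProb.gaussianLaw ρ := by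
    -- The aperture `1` is arbitrary, as everything holds on the whole half-plane `Im w > 5` where
    -- `g` is controlled.
    refine ⟨1, one_pos, 5, by norm_num, fun w => w⁻¹, fun w => g w - w,
      FreeProb.isVoiculescuTransform_semicircleLaw 1, ?_,
      FreeProb.isVoiculescuTransform_of_cauchyTransform_eq_sub_subordination hρ hgd hg⟩
    refine .of_norm_le (hgd.sub differentiableOn_id) (fun w hw => (hg w hw).2.2)
      (fun w hw => ?_) fun w hw => ?_
    · rw [add_sub_cancel]
      linarith [(hg w hw).1]
    · rw [add_sub_cancel]
      exact (hg w hw).2.1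
  exact ⟨ρ, hconv, fun ρ' h' => h'.unique hconv, FreeProb.subordinationDensity FreeProb.gaussianLaw,
    FreeProb.continuous_subordinationDensity hb, FreeProb.subordinationDensity_nonneg hb, hdens,
    FreeProb.exists_subordinationDensity_gaussianLaw_le⟩
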